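/- Let $k\ge 2$ be an even integer and let $W$ be a binary-input symmetric-output (BISO) channel with finite output alphabet $\mathcal Y$: $W(\cdot|0)$ and $W(\cdot|1)$ are probability distributions on $\mathcal Y$, and there is an involution $\sigma$ of $\mathcal Y$ with $W(z|1)=W(\sigma(z)|0)$ for all $z\in\mathcal Y$. Let $C(W)$ be the capacity of $W$, the supremum of the mutual information (in bits) between the input and the output of $W$ over all input distributions. For $\alpha>0$ and $n\ge k$, draw a random $k$-uniform hypergraph $g$ on the vertex set $\{1,\dots,n\}$ from one of the following two ensembles. In the Poisson ensemble $\mathcal P_k(\alpha,n)$, the multiplicities of the $\binom nk$ possible hyperedges are independent Poisson variables of parameter $p=\alpha n/\binom nk$. In the Erdős–Rényi ensemble, each hyperedge is present independently with probability $\min(p,1)$. Let $m$ be the number of edges of $g$, counted with multiplicity. The associated LDGM code of constant right degree $k$ has the $n\times m$ generator matrix $G$ over $GF(2)$ with one column for each edge of $g$, whose $k$ ones are at the vertices of that edge. Let $X$ be uniform in $GF(2)^n$ (for given $g$), let $U=XG$, and let $Y\in\mathcal Y^m$ be the output of the memoryless channel $W$ on input $U$. Let $I_g(X;Y)$ be the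 mutual information, in bits, for a given $g$; it is a random variable through $g$. (1) For every $\alpha>0$ there is a constant $C_k(\alpha,W)$, the same for both ensembles, such that, as $n\to\infty$, $$\frac1n I_g(X;Y)\longrightarrow C_k(\alpha,W)\quad\text{in probability.}$$ (2) Consequently, the ratio $\frac1m I_g(X;Y)$ has a threshold in $\alpha$: if $C(W)>0$, there is a constant $C_k(W)\in[0,\infty)$ such that, for both ensembles and every $\alpha>0$, - if $\alpha<C_k(W)$, then $\mathbb P\{I_g(X;Y)<(C(W)-\varepsilon)\,m\}\to0$ as $n\to\infty$ for every $\varepsilon>0$; - if $\alpha>C_k(W)$, then $\mathbb P\{I_g(X;Y)<(C(W)-\varepsilon)\,m\}\to1$ as $n\to\infty$ for some $\varepsilon>0$; in particular $\mathbb P\{I_g(X;Y)<C(W)\,m\}\to1$. -/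

import Mathlib

open MeasureTheory ProbabilityTheory Filter Topology

noncomputable section

namespace LDGM

/-! ### Finite information theory (entropies in bits) -/

/-- The mutual information, in bits, of a pair of finite random variables with joint probability
mass function `p`. Terms with `p a b = 0` vanish. -/
def mutualInfo {A B : Type*} [Fintype A] [Fintype B] (p : A → B → ℝ) : ℝ :=
  ∑ a, ∑ b, p a b * Real.logb 2 (p a b / ((∑ b', p a b') * (∑ a', p a' b)))

/-- A binary-input symmetric-output channel: `W x z` is the probability of the output `z` when the
input bit is `x`, and some involution of the output alphabet exchanges the two rows of `W`. -/
structure IsBISO {𝒴 : Type*} [Fintype 𝒴] (W : ZMod 2 → 𝒴 → ℝ) : Prop where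
  nonneg : ∀ x z, 0 ≤ W x z
  sum_eq_one : ∀ x, ∑ z, W x z = 1
  symmetric : ∃ σ : 𝒴 → 𝒴, Function.Involutive σ ∧ ∀ z, W 1 z = W 0 (σ z)

/-- The capacity, in bits, of a binary-input channel: the supremum of the mutual information
between input and output over all input distributions. -/
def capacity {𝒴 : Type*} [Fintype 𝒴] (W : ZMod 2 → 𝒴 → ℝ) : ℝ :=
  ⨆ q : stdSimplex ℝ (ZMod 2), mutualInfo fun x z => (q : ZMod 2 → ℝ) x * W x z

/-! ### Random sparse hypergraphs -/

/-- The hyperedges of order `k` on the vertex set `Fin n`. -/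
abbrev HyperEdge (k n : ℕ) : Type := {I : Finset (Fin n) // I.card = k}

/-- A `k`-uniform multi-hypergraph on `Fin n`, given by the multiplicity of every hyperedge. -/
abbrev MultiHypergraph (k n : ℕ) : Type := HyperEdge k n → ℕ

/-- The edges of `g`, every hyperedge being repeated according to its multiplicity. -/
abbrev Edge {k n : ℕ} (g : MultiHypergraph k n) : Type := Σ I : HyperEdge k n, Fin (g I)

/-- The number of edges of `g`, with multiplicity. -/
def numEdges {k n : ℕ} (g : MultiHypergraph k n) : ℕ := Fintype.card (Edge g)

/-- The two sparse random hypergraph models. -/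
inductive Model
  | poisson
  | erdosRenyi

/-- The law of the multiplicity of one hyperedge: Poisson with parameter `p`, respectively
Bernoulli with parameter `p` (cut off at `1` if `p` exceeds `1`). -/
def Model.edgeLaw : Model → NNReal → Measure ℕ
  | .poisson, p => poissonMeasure p
  | .erdosRenyi, p => bernoulliMeasure 1 0 ⟨min p 1, (min p 1).2, by simp⟩

/-- The random `k`-uniform hypergraph on `n` vertices of edge density `α`: the multiplicities of
the hyperedges are independent, with the edge law of parameter `α n / (n choose k)`. -/
def ensemble (M : Model) (k : ℕ) (α : NNReal) (n : ℕ) : Measure (MultiHypergraph k n) :=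
  Measure.pi fun _ => M.edgeLaw (α * n / n.choose k)

/-! ### LDGM codes -/

/-- The generator matrix of the code of `g`: there is one column for each edge of `g`, and its ones
are at the `k` vertices of that edge. -/
def generatorMatrix {k n : ℕ} (g : MultiHypergraph k n) : Matrix (Fin n) (Edge g) (ZMod 2) :=
  Matrix.of fun i e => if i ∈ e.1.1 then 1 else 0

/-- The joint probability mass function of the uniform information word `X` in `GF(2)^n` and the
output `Y` of the memoryless channel `W` used on the codeword `U = X G`. -/
def jointLaw {𝒴 : Type*} (W : ZMod 2 → 𝒴 → ℝ) {k n : ℕ} (g : MultiHypergraph k n)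
    (x : Fin n → ZMod 2) (y : Edge g → 𝒴) : ℝ :=
  (2 ^ n : ℝ)⁻¹ * ∏ e, W (Matrix.vecMul x (generatorMatrix g) e) (y e)

/-- The mutual information `I(X; Y)`, in bits, for a given graph `g`. -/
def codeInfo {𝒴 : Type*} [Fintype 𝒴] (W : ZMod 2 → 𝒴 → ℝ) {k n : ℕ}
    (g : MultiHypergraph k n) : ℝ :=
  mutualInfo (jointLaw W g)

end LDGM

end

/-!
The code bits of the hypergraph `g` are parities of the uniform word `X`, observed through independent
copies of the channel `W`. The information `I(X; Y)` depends only on the multiset of observed parities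
(`obsInfo`). By the chain rule (`familyInfo_option`), observing one more parity adds the mean of
`bitInfo W θ` over the outputs so far, where `θ` is the conditional mean of the sign of the new bit
(`bias`). For a symmetric channel `bitInfo W θ` is at most its value at `θ = 0`, which is the capacity
(`capacity_eq`), and it is an affine function of the even moments of `θ` with nonpositive coefficients
(`bitInfo_eq`, `hasSum_entropyDeficit`, `sum_bitInfo_le`).

*Interpolation.* Let the new parity be that of a uniformly random `k`-tuple of vertices, repetitions
allowed. Introducing `r` replicas of `X`, independent given `Y`, the mean of `θ ^ r` over the tuple is
the mean over the replicas of the `k`-th power of an average over the vertices (`sum_tuple_moment`).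
When `k` is even this power is convex, so a tuple from all of `n₁ + n₂` vertices is at least as
informative as one from one of two disjoint blocks, chosen in proportion to their sizes
(`sum_obsInfo_split_le`).

*Poisson superpositions.* The mean of a bounded function over independent Poisson multiplicities is the
exponential of a generator built from commuting shift operators (`poissonOp`,
`integral_pi_poissonMeasure`). Interpolating linearly between two generators shows that an
inequality between the generators, at every configuration, passes to the means (`poissonOp_le_add`).
This gives three facts on the mean information `tupleInfo` of a Poisson number of random tuples: it is
superadditive in the number of vertices (`tupleInfo_superadditive`), hence it has a limit `c α` per
vertex by Fekete's lemma; it differs by a bounded amount from the mean in the Poisson ensemble, where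
tuples with repetitions are absent (`abs_integral_codeInfo_poisson_sub_le`); and the deficit
`C(W) α - c α` is nonnegative and nondecreasing in `α` (`tupleInfo_le_add`).

*Concentration.* Removing an edge changes the information by at most one bit, so that the variance is
`O(n)` by the Efron–Stein bound (`integral_sq_sub_le`), while replacing the Poisson by Bernoulli
multiplicities one at a time changes the mean by `o(n)` (`abs_integral_pi_sub_le`). Chebyshev's
inequality gives the convergence in probability for both ensembles (`tendsto_codeInfo_div`).

*Threshold.* The number of edges is close to `α n`, so that `I / m` falls short of the capacity exactly
when the deficit is positive. The threshold is the supremum of the `α` with deficit zero; it is finite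
because `c α ≤ 1`.
-/

noncomputable section

namespace LDGM

open scoped NNReal BoundedContinuousFunction

/-! ### Mutual information of a family of noisy parity observations -/

section Family

open Real

variable {𝒴 : Type*} [Fintype 𝒴] {W : ZMod 2 → 𝒴 → ℝ}
  {X X₁ X₂ : Type*}
  {E E' : Type*} [Fintype E] [DecidableEq E] [Fintype E'] [DecidableEq E']

/-- The probability of the outputs `y` given `x`, when the bits `u e x` are sent through
independent copies of the channel `W`. -/
def likelihood (W : ZMod 2 → 𝒴 → ℝ) (u : E → X → ZMod 2) (y : E → 𝒴) (x : X) : ℝ :=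
  ∏ e, W (u e x) (y e)

/-- The law of the outputs when `x` is uniform on `X` and the bits `u e x` are sent through
independent copies of the channel `W`. -/
def outputLaw [Fintype X] (W : ZMod 2 → 𝒴 → ℝ) (u : E → X → ZMod 2) (y : E → 𝒴) : ℝ :=
  (Fintype.card X : ℝ)⁻¹ * ∑ x, likelihood W u y x

/-- The entropy, in nats, of the output of the channel for a fixed input bit; by symmetry the choice
of the bit is immaterial. -/
def noiseEntropy (W : ZMod 2 → 𝒴 → ℝ) : ℝ := ∑ z, negMulLog (W 0 z)

/-- The mutual information, in bits, between a uniform `x` in `X` and the outputs of independent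
copies of `W` on the bits `u e x`, written as output entropy minus noise entropy. -/
def familyInfo [Fintype X] (W : ZMod 2 → 𝒴 → ℝ) (u : E → X → ZMod 2) : ℝ :=
  (∑ y, negMulLog (outputLaw W u y) - Fintype.card E * noiseEntropy W) / log 2

lemma zmod_two_cases (b : ZMod 2) : b = 0 ∨ b = 1 := by
  fin_cases b
  · exact Or.inl rfl
  · exact Or.inr rfl

lemma likelihood_nonneg {E : Type*} [Fintype E] (hW : IsBISO W)
    (u : E → X → ZMod 2) (y : E → 𝒴) (x : X) :
    0 ≤ likelihood W u y x :=
  Finset.prod_nonneg fun _ _ => hW.nonneg _ _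

lemma outputLaw_nonneg {E : Type*} [Fintype E] [Fintype X] (hW : IsBISO W)
    (u : E → X → ZMod 2) (y : E → 𝒴) :
    0 ≤ outputLaw W u y :=
  mul_nonneg (by positivity) (Finset.sum_nonneg fun _ _ => likelihood_nonneg hW _ _ _)

lemma sum_negMulLog_channel (hW : IsBISO W) (b : ZMod 2) :
    ∑ z, negMulLog (W b z) = noiseEntropy W := by
  obtain ⟨σ, hσ, h⟩ := hW.symmetric
  rcases zmod_two_cases b with rfl | rfl
  · rfl
  · simp only [h, noiseEntropy]
    exact Equiv.sum_comp hσ.toPerm (fun z => negMulLog (W 0 z))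

lemma sum_likelihood (hW : IsBISO W) (u : E → X → ZMod 2) (x : X) :
    ∑ y, likelihood W u y x = 1 := by
  simp only [likelihood]
  rw [← Fintype.prod_sum (fun e z => W (u e x) z)]
  simp [hW.sum_eq_one]

lemma sum_outputLaw [Fintype X] [Nonempty X] (hW : IsBISO W) (u : E → X → ZMod 2) :
    ∑ y, outputLaw W u y = 1 := by
  simp only [outputLaw, ← Finset.mul_sum]
  rw [Finset.sum_comm]
  simp only [sum_likelihood hW, Finset.sum_const, Finset.card_univ, nsmul_eq_mul, mul_one]
  exact inv_mul_cancel₀ (by exact_mod_cast Fintype.card_ne_zero)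

/-- Given `x` the outputs are independent, so their entropies add up. -/
lemma sum_negMulLog_likelihood (hW : IsBISO W) (u : E → X → ZMod 2) (x : X) :
    ∑ y, negMulLog (likelihood W u y x) = Fintype.card E * noiseEntropy W := by
  have key : ∀ y : E → 𝒴, negMulLog (likelihood W u y x) =
      ∑ e, ∏ e', if e' = e then negMulLog (W (u e' x) (y e')) else W (u e' x) (y e') := by
    intro y
    have h1 : ∀ e, (∏ e', if e' = e then negMulLog (W (u e' x) (y e')) else W (u e' x) (y e'))
        = - (likelihood W u y x * log (W (u e x) (y e))) := by
      intro e
      rw [likelihood, ← Finset.mul_prod_erase _ _ (Finset.mem_univ e),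
        ← Finset.mul_prod_erase _ (fun e => W (u e x) (y e)) (Finset.mem_univ e)]
      have : ∏ e' ∈ Finset.univ.erase e,
          (if e' = e then negMulLog (W (u e' x) (y e')) else W (u e' x) (y e')) =
          ∏ e' ∈ Finset.univ.erase e, W (u e' x) (y e') :=
        Finset.prod_congr rfl fun e' he' => by rw [if_neg (Finset.ne_of_mem_erase he')]
      rw [this]
      simp [negMulLog]
      ring
    simp only [h1, Finset.sum_neg_distrib, ← Finset.mul_sum]
    rw [negMulLog, neg_mul]
    by_cases h0 : likelihood W u y x = 0
    · simp [h0]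
    · congr 1
      rw [likelihood, log_prod]
      intro e _ he
      exact h0 (Finset.prod_eq_zero (Finset.mem_univ e) he)
  simp only [key]
  rw [Finset.sum_comm]
  have h2 : ∀ e, ∑ y : E → 𝒴, ∏ e', (if e' = e then negMulLog (W (u e' x) (y e'))
      else W (u e' x) (y e')) = noiseEntropy W := by
    intro e
    rw [← Fintype.prod_sum (fun e' z => if e' = e then negMulLog (W (u e' x) z)
      else W (u e' x) z), Finset.prod_eq_single e]
    · simp [sum_negMulLog_channel hW]
    · intro e' _ he'
      simp [he', hW.sum_eq_one]
    · simp
  simp [h2]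

lemma codeInfo_eq_familyInfo (hW : IsBISO W) {k n : ℕ} (g : MultiHypergraph k n) :
    codeInfo W g =
      familyInfo W (fun (e : Edge g) x => Matrix.vecMul x (generatorMatrix g) e) := by
  set u : Edge g → (Fin n → ZMod 2) → ZMod 2 :=
    fun e x => Matrix.vecMul x (generatorMatrix g) e with hu
  have hc : (Fintype.card (Fin n → ZMod 2) : ℝ) = 2 ^ n := by simp [ZMod.card]
  have hj : ∀ x y, jointLaw W g x y = (2 ^ n : ℝ)⁻¹ * likelihood W u y x := fun x y => rfl
  have hx : ∀ x, ∑ y, jointLaw W g x y = (2 ^ n : ℝ)⁻¹ := fun x => by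
    simp only [hj, ← Finset.mul_sum, sum_likelihood hW, mul_one]
  have hy : ∀ y, ∑ x, jointLaw W g x y = outputLaw W u y := fun y => by
    simp only [hj, ← Finset.mul_sum, outputLaw, hc]
  have hterm : ∀ x y, jointLaw W g x y *
      logb 2 (jointLaw W g x y / ((∑ y', jointLaw W g x y') * ∑ x', jointLaw W g x' y)) =
      (- ((2 ^ n : ℝ)⁻¹ * negMulLog (likelihood W u y x))
        - (2 ^ n : ℝ)⁻¹ * likelihood W u y x * log (outputLaw W u y)) / log 2 := by
    intro x y
    rw [hx, hy, hj, mul_div_mul_left _ _ (by positivity)]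
    by_cases h0 : likelihood W u y x = 0
    · simp [h0]
    · have hpos : 0 < likelihood W u y x := lt_of_le_of_ne (likelihood_nonneg hW _ _ _) (Ne.symm h0)
      have hP : outputLaw W u y ≠ 0 := by
        rw [outputLaw]
        refine (mul_pos (by rw [hc]; positivity) (lt_of_lt_of_le hpos ?_)).ne'
        exact Finset.single_le_sum (fun x _ => likelihood_nonneg hW u y x) (Finset.mem_univ x)
      rw [logb, log_div h0 hP, negMulLog]
      ring
  rw [codeInfo, mutualInfo, familyInfo]
  simp only [hterm, ← Finset.sum_div]
  congr 1
  simp only [Finset.sum_sub_distrib, Finset.sum_neg_distrib, ← Finset.mul_sum,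
    sum_negMulLog_likelihood hW]
  rw [Finset.sum_comm (f := fun x y => (2 ^ n : ℝ)⁻¹ * likelihood W u y x * log (outputLaw W u y))]
  simp only [← Finset.sum_mul, ← Finset.mul_sum]
  have : ∀ y, (2 ^ n : ℝ)⁻¹ * (∑ x, likelihood W u y x) * log (outputLaw W u y) =
      - negMulLog (outputLaw W u y) := fun y => by
    rw [negMulLog, outputLaw, hc]; ring
  simp only [this, Finset.sum_neg_distrib, Finset.sum_const, Finset.card_univ, nsmul_eq_mul, hc]
  field_simp
  ring

/-- The conditional entropy of `x` given the outputs is nonnegative. -/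
lemma familyInfo_le [Fintype X] [Nonempty X] (hW : IsBISO W) (u : E → X → ZMod 2) :
    familyInfo W u ≤ log (Fintype.card X) / log 2 := by
  set N : ℝ := (Fintype.card X : ℝ) with hN
  have hNpos : 0 < N := by rw [hN]; exact_mod_cast Fintype.card_pos
  have hterm : ∀ y, negMulLog (outputLaw W u y) ≤
      ∑ x, N⁻¹ * (negMulLog (likelihood W u y x) + likelihood W u y x * log N) := by
    intro y
    have h1 : negMulLog (outputLaw W u y) =
        ∑ x, N⁻¹ * (- (likelihood W u y x * log (outputLaw W u y))) := by
      rw [negMulLog, ← Finset.mul_sum, Finset.sum_neg_distrib, ← Finset.sum_mul]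
      nth_rw 1 [outputLaw]
      ring
    rw [h1]
    refine Finset.sum_le_sum fun x _ => mul_le_mul_of_nonneg_left ?_ (by positivity)
    rcases (likelihood_nonneg hW u y x).eq_or_lt with h0 | hpos
    · simp [← h0]
    · have hle : N⁻¹ * likelihood W u y x ≤ outputLaw W u y :=
        mul_le_mul_of_nonneg_left
          (Finset.single_le_sum (fun x _ => likelihood_nonneg hW u y x) (Finset.mem_univ x))
          (by positivity)
      have := log_le_log (by positivity) hle
      rw [log_mul (by positivity) hpos.ne', log_inv] at this
      rw [negMulLog]
      nlinarith
  rw [familyInfo]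
  refine div_le_div_of_nonneg_right ?_ (log_nonneg (by norm_num))
  have := Finset.sum_le_sum fun y (_ : y ∈ Finset.univ) => hterm y
  rw [Finset.sum_comm] at this
  simp only [← Finset.mul_sum, Finset.sum_add_distrib, ← Finset.sum_mul,
    sum_negMulLog_likelihood hW, sum_likelihood hW, Finset.sum_const, Finset.card_univ,
    nsmul_eq_mul, ← hN] at this
  have e : N⁻¹ * (N * (↑(Fintype.card E) * noiseEntropy W) + N * 1 * log N) =
      ↑(Fintype.card E) * noiseEntropy W + log N := by field_simp
  linarith

/-- Relabelling the observations does not change the information. -/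
lemma familyInfo_comp_equiv [Fintype X] (e : E' ≃ E) (u : E → X → ZMod 2) :
    familyInfo W (u ∘ e) = familyInfo W u := by
  rw [familyInfo, familyInfo, Fintype.card_congr e]
  congr 2
  refine Fintype.sum_equiv (e.arrowCongr (Equiv.refl 𝒴)) _ _ fun y => ?_
  simp only [outputLaw, likelihood]
  congr 2
  exact Finset.sum_congr rfl fun x _ => Fintype.prod_equiv e _ _ fun a => by simp

/-- The information depends only on the multiset of observed bits, not on how they are indexed. -/
lemma familyInfo_congr [Fintype X] {u : E → X → ZMod 2} {u' : E' → X → ZMod 2}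
    (h : Finset.univ.val.map u = Finset.univ.val.map u') : familyInfo W u = familyInfo W u' := by
  have hfib : ∀ v, Nonempty ({e // u e = v} ≃ {e // u' e = v}) := by
    intro v
    refine ⟨Fintype.equivOfCardEq ?_⟩
    have := congrArg (Multiset.count v) h
    rw [Multiset.count_map, Multiset.count_map] at this
    rw [Fintype.card_subtype, Fintype.card_subtype, Finset.card_def, Finset.card_def,
      Finset.filter_val, Finset.filter_val]
    simpa only [eq_comm] using this
  let φ := fun v => (hfib v).some
  let e : E ≃ E' :=
    (Equiv.sigmaFiberEquiv u).symm.trans ((Equiv.sigmaCongrRight φ).trans (Equiv.sigmaFiberEquiv u'))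
  have he : u' ∘ e = u := by
    funext a
    exact (φ (u a) ⟨a, rfl⟩).2
  rw [← he, familyInfo_comp_equiv]

/-- The information is additive over families observing independent components of `x`. -/
lemma familyInfo_prod [Fintype X] [Fintype X₁] [Fintype X₂] [Nonempty X]
    (hW : IsBISO W) (p : X ≃ X₁ × X₂) (u : E → X₁ → ZMod 2)
    (v : E' → X₂ → ZMod 2) :
    familyInfo W (Sum.elim (fun e x => u e (p x).1) fun e x => v e (p x).2) =
      familyInfo W u + familyInfo W v := by
  have hX : Nonempty (X₁ × X₂) := ⟨p (Classical.arbitrary X)⟩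
  have hX₁ : Nonempty X₁ := ⟨hX.some.1⟩
  have hX₂ : Nonempty X₂ := ⟨hX.some.2⟩
  have hP : ∀ y : E → 𝒴, ∀ y' : E' → 𝒴,
      outputLaw W (Sum.elim (fun e x => u e (p x).1) fun e x => v e (p x).2) (Sum.elim y y') =
      outputLaw W u y * outputLaw W v y' := by
    intro y y'
    simp only [outputLaw, likelihood, Fintype.prod_sum_type, Sum.elim_inl, Sum.elim_inr]
    rw [Fintype.card_congr p, Fintype.card_prod,
      Equiv.sum_comp p (fun q => (∏ e, W (u e q.1) (y e)) * ∏ e, W (v e q.2) (y' e)),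
      Fintype.sum_prod_type]
    simp only [← Finset.mul_sum, ← Finset.sum_mul]
    push_cast
    rw [mul_inv]
    ring
  rw [familyInfo, familyInfo, familyInfo, ← add_div]
  congr 1
  rw [← Equiv.sum_comp (Equiv.sumArrowEquivProdArrow E E' 𝒴).symm, Fintype.sum_prod_type]
  have : ∀ y : E → 𝒴, ∀ y' : E' → 𝒴,
      (Equiv.sumArrowEquivProdArrow E E' 𝒴).symm (y, y') = Sum.elim y y' := fun _ _ => rfl
  simp only [this, hP, negMulLog_mul, Finset.sum_add_distrib, ← Finset.mul_sum, ← Finset.sum_mul,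
    sum_outputLaw hW, Fintype.card_sum]
  push_cast
  ring

end Family

/-! ### The information carried by one biased bit -/

section Bit

open Real

variable {𝒴 : Type*} [Fintype 𝒴] {W : ZMod 2 → 𝒴 → ℝ}

/-- The sign `(-1) ^ b` of a bit `b`. -/
def bitSign (b : ZMod 2) : ℝ := if b = 0 then 1 else -1

@[simp] lemma bitSign_zero : bitSign 0 = 1 := by simp [bitSign]

@[simp] lemma bitSign_one : bitSign 1 = -1 := by simp [bitSign]

lemma bitSign_add (a b : ZMod 2) : bitSign (a + b) = bitSign a * bitSign b := by
  rcases zmod_two_cases a with rfl | rfl <;> rcases zmod_two_cases b with rfl | rfl <;>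
    simp [bitSign, show (1 : ZMod 2) + 1 = 0 from rfl]

lemma bitSign_sum {ι : Type*} (s : Finset ι) (f : ι → ZMod 2) :
    bitSign (∑ i ∈ s, f i) = ∏ i ∈ s, bitSign (f i) := by
  classical
  induction s using Finset.induction_on with
  | empty => simp
  | insert a s ha ih => rw [Finset.sum_insert ha, Finset.prod_insert ha, bitSign_add, ih]

lemma abs_bitSign (b : ZMod 2) : |bitSign b| = 1 := by
  rcases zmod_two_cases b with rfl | rfl <;> simp

/-- The output law of the channel for a random input bit with mean sign `θ`. -/
def mixedOutput (W : ZMod 2 → 𝒴 → ℝ) (θ : ℝ) (z : 𝒴) : ℝ :=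
  (1 + θ) / 2 * W 0 z + (1 - θ) / 2 * W 1 z

/-- The mutual information, in nats, between input and output of the channel for a random input bit
with mean sign `θ`. -/
def bitInfo (W : ZMod 2 → 𝒴 → ℝ) (θ : ℝ) : ℝ :=
  ∑ z, negMulLog (mixedOutput W θ z) - noiseEntropy W

lemma channel_eq_mixedOutput {𝒴 : Type*} {W : ZMod 2 → 𝒴 → ℝ} (b : ZMod 2) (z : 𝒴) :
    W b z = mixedOutput W (bitSign b) z := by
  rcases zmod_two_cases b with rfl | rfl <;> simp [mixedOutput]

lemma sum_mixedOutput (hW : IsBISO W) (θ : ℝ) : ∑ z, mixedOutput W θ z = 1 := by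
  simp only [mixedOutput, Finset.sum_add_distrib, ← Finset.mul_sum, hW.sum_eq_one]
  ring

lemma bitInfo_neg (hW : IsBISO W) (θ : ℝ) : bitInfo W (-θ) = bitInfo W θ := by
  obtain ⟨σ, hσ, h⟩ := hW.symmetric
  rw [bitInfo, bitInfo, ← Equiv.sum_comp hσ.toPerm]
  congr 1
  refine Finset.sum_congr rfl fun z _ => ?_
  simp only [mixedOutput, h, Function.Involutive.coe_toPerm, hσ z]
  congr 1
  ring

lemma bitInfo_nonneg (hW : IsBISO W) {θ : ℝ} (hθ : |θ| ≤ 1) : 0 ≤ bitInfo W θ := by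
  obtain ⟨h1, h2⟩ := abs_le.1 hθ
  have : ∀ z, (1 + θ) / 2 * negMulLog (W 0 z) + (1 - θ) / 2 * negMulLog (W 1 z) ≤
      negMulLog (mixedOutput W θ z) := fun z =>
    concaveOn_negMulLog.2 (hW.nonneg 0 z) (hW.nonneg 1 z) (by linarith) (by linarith) (by ring)
  have := Finset.sum_le_sum fun z (_ : z ∈ Finset.univ) => this z
  simp only [Finset.sum_add_distrib, ← Finset.mul_sum, sum_negMulLog_channel hW] at this
  rw [bitInfo]
  linarith

lemma mixedOutput_nonneg (hW : IsBISO W) {θ : ℝ} (hθ : |θ| ≤ 1) (z : 𝒴) :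
    0 ≤ mixedOutput W θ z := by
  obtain ⟨h1, h2⟩ := abs_le.1 hθ
  exact add_nonneg (mul_nonneg (by linarith) (hW.nonneg _ _))
    (mul_nonneg (by linarith) (hW.nonneg _ _))

/-- By symmetry and concavity an unbiased bit is the most informative one. -/
lemma bitInfo_le_zero (hW : IsBISO W) {θ : ℝ} (hθ : |θ| ≤ 1) : bitInfo W θ ≤ bitInfo W 0 := by
  have : ∀ z, (1 / 2 : ℝ) * negMulLog (mixedOutput W θ z) +
      (1 / 2 : ℝ) * negMulLog (mixedOutput W (-θ) z) ≤ negMulLog (mixedOutput W 0 z) := by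
    intro z
    have := concaveOn_negMulLog.2 (mixedOutput_nonneg hW hθ z)
      (mixedOutput_nonneg hW (by rwa [abs_neg] : |-θ| ≤ 1) z)
      (by norm_num : (0 : ℝ) ≤ 1 / 2) (by norm_num : (0 : ℝ) ≤ 1 / 2) (by norm_num)
    refine this.trans (le_of_eq ?_)
    congr 1
    simp only [mixedOutput, smul_eq_mul]
    ring
  have := Finset.sum_le_sum fun z (_ : z ∈ Finset.univ) => this z
  simp only [Finset.sum_add_distrib, ← Finset.mul_sum] at this
  have h := bitInfo_neg hW θ
  simp only [bitInfo] at h ⊢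
  linarith

lemma bitInfo_zero_le_log_two (hW : IsBISO W) : bitInfo W 0 ≤ log 2 := by
  have key : ∀ a b : ℝ, 0 ≤ a → 0 ≤ b → negMulLog ((a + b) / 2) ≤
      negMulLog a / 2 + negMulLog b / 2 + (a + b) / 2 * log 2 := by
    have half : ∀ a b : ℝ, 0 ≤ a → 0 ≤ b → a * log a - a * log 2 ≤ a * log ((a + b) / 2) := by
      intro a b ha hb
      rcases ha.eq_or_lt with rfl | ha
      · simp
      · rw [← mul_sub, ← log_div ha.ne' two_ne_zero]
        exact mul_le_mul_of_nonneg_left (log_le_log (by positivity) (by linarith)) ha.le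
    intro a b ha hb
    have h1 := half a b ha hb
    have h2 := half b a hb ha
    rw [add_comm b a] at h2
    simp only [negMulLog]
    linarith
  have := Finset.sum_le_sum fun z (_ : z ∈ Finset.univ) =>
    key (W 0 z) (W 1 z) (hW.nonneg _ _) (hW.nonneg _ _)
  simp only [Finset.sum_add_distrib, ← Finset.sum_div, ← Finset.sum_mul,
    sum_negMulLog_channel hW, hW.sum_eq_one] at this
  have e : ∀ z, mixedOutput W 0 z = (W 0 z + W 1 z) / 2 := fun z => by rw [mixedOutput]; ring
  simp only [bitInfo, e]
  linarith

lemma mutualInfo_input (hW : IsBISO W) (q : ZMod 2 → ℝ) (hq : q ∈ stdSimplex ℝ (ZMod 2)) :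
    (mutualInfo fun x z => q x * W x z) = bitInfo W (q 0 - q 1) / log 2 := by
  have hsum : q 0 + q 1 = 1 := by
    have := hq.2
    rwa [show (Finset.univ : Finset (ZMod 2)) = {0, 1} from rfl,
      Finset.sum_pair (by decide)] at this
  have hout : ∀ z, ∑ x, q x * W x z = mixedOutput W (q 0 - q 1) z := by
    intro z
    rw [show (Finset.univ : Finset (ZMod 2)) = {0, 1} from rfl, Finset.sum_pair (by decide),
      mixedOutput, show q 1 = 1 - q 0 by linarith]
    ring
  have hterm : ∀ x z, q x * W x z * logb 2 (q x * W x z / ((∑ z', q x * W x z') *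
      ∑ x', q x' * W x' z)) =
      (- (q x * negMulLog (W x z)) - q x * W x z * log (mixedOutput W (q 0 - q 1) z)) / log 2 := by
    intro x z
    rw [hout, ← Finset.mul_sum, hW.sum_eq_one, mul_one]
    by_cases h0 : q x * W x z = 0
    · rcases mul_eq_zero.1 h0 with h | h <;> simp [h]
    · have hq0 : q x ≠ 0 := left_ne_zero_of_mul h0
      have hW0 : W x z ≠ 0 := right_ne_zero_of_mul h0
      have hm : mixedOutput W (q 0 - q 1) z ≠ 0 := by
        rw [← hout]
        refine (lt_of_lt_of_le (lt_of_le_of_ne (mul_nonneg (hq.1 x) (hW.nonneg x z)) (Ne.symm h0))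
          (Finset.single_le_sum (f := fun x => q x * W x z)
            (fun x _ => mul_nonneg (hq.1 x) (hW.nonneg x z)) (Finset.mem_univ x))).ne'
      rw [mul_div_mul_left _ _ hq0, logb, log_div hW0 hm, negMulLog]
      ring
  rw [mutualInfo]
  simp only [hterm, ← Finset.sum_div]
  congr 1
  simp only [Finset.sum_sub_distrib, Finset.sum_neg_distrib, ← Finset.mul_sum,
    sum_negMulLog_channel hW]
  rw [← Finset.sum_mul, hq.2, Finset.sum_comm]
  simp only [← Finset.sum_mul, hout, bitInfo, negMulLog, neg_mul, Finset.sum_neg_distrib]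
  ring

/-- The capacity is attained by the uniform input. -/
lemma capacity_eq (hW : IsBISO W) : capacity W = bitInfo W 0 / log 2 := by
  have hle : ∀ q : stdSimplex ℝ (ZMod 2),
      (mutualInfo fun x z => (q : ZMod 2 → ℝ) x * W x z) ≤ bitInfo W 0 / log 2 := by
    intro q
    rw [mutualInfo_input hW q q.2]
    refine div_le_div_of_nonneg_right (bitInfo_le_zero hW ?_) (log_nonneg (by norm_num))
    have h0 := q.2.1 0
    have h1 := q.2.1 1
    have hsum := q.2.2
    rw [show (Finset.univ : Finset (ZMod 2)) = {0, 1} from rfl,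
      Finset.sum_pair (by decide)] at hsum
    exact abs_le.2 (by constructor <;> linarith : -1 ≤ q.1 0 - q.1 1 ∧ q.1 0 - q.1 1 ≤ 1)
  have hmem : (fun _ => 1 / 2 : ZMod 2 → ℝ) ∈ stdSimplex ℝ (ZMod 2) := by
    refine ⟨fun _ => by norm_num, ?_⟩
    rw [show (Finset.univ : Finset (ZMod 2)) = {0, 1} from rfl, Finset.sum_pair (by decide)]
    norm_num
  have : Nonempty (stdSimplex ℝ (ZMod 2)) := ⟨⟨_, hmem⟩⟩
  refine le_antisymm (ciSup_le hle) ?_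
  refine le_trans (le_of_eq ?_) (le_ciSup ⟨_, Set.forall_mem_range.2 hle⟩ ⟨_, hmem⟩)
  exact (by simp : bitInfo W 0 / log 2 = bitInfo W (1 / 2 - 1 / 2) / log 2).trans
    (mutualInfo_input hW _ hmem).symm

lemma capacity_nonneg (hW : IsBISO W) : 0 ≤ capacity W := by
  rw [capacity_eq hW]
  exact div_nonneg (bitInfo_nonneg hW (by simp)) (log_nonneg (by norm_num))

lemma capacity_le_one (hW : IsBISO W) : capacity W ≤ 1 := by
  rw [capacity_eq hW]
  exact div_le_one_of_le₀ (bitInfo_zero_le_log_two hW) (log_nonneg (by norm_num))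

/-- The entropy deficit `(1 + u) log (1 + u) + (1 - u) log (1 - u)`. -/
def entropyDeficit (u : ℝ) : ℝ := (1 + u) * log (1 + u) + (1 - u) * log (1 - u)

lemma continuous_entropyDeficit : Continuous entropyDeficit :=
  (continuous_mul_log.comp (continuous_const.add continuous_id)).add
    (continuous_mul_log.comp (continuous_const.sub continuous_id))

/-- The entropy deficit is an even power series with nonnegative coefficients. -/
lemma hasSum_entropyDeficit {u : ℝ} (hu : |u| < 1) :
    HasSum (fun j : ℕ => (2 / (2 * j + 1) - 1 / (j + 1)) * u ^ (2 * (j + 1)))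
      (entropyDeficit u) := by
  obtain ⟨h1, h2⟩ := abs_lt.1 hu
  have hu2 : |u ^ 2| < 1 := by
    rw [abs_pow]
    exact pow_lt_one₀ (abs_nonneg _) hu two_ne_zero
  have h := ((hasSum_log_sub_log_of_abs_lt_one hu).mul_left u).sub
    (hasSum_pow_div_log_of_abs_lt_one hu2)
  have e1 : (fun j : ℕ => (2 / (2 * (j : ℝ) + 1) - 1 / (j + 1)) * u ^ (2 * (j + 1))) =
      fun j : ℕ => u * (2 * (1 / (2 * (j : ℝ) + 1)) * u ^ (2 * j + 1)) -
        (u ^ 2) ^ (j + 1) / ((j : ℝ) + 1) := by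
    funext j
    have : (2 * (j : ℝ) + 1) ≠ 0 := by positivity
    have : ((j : ℝ) + 1) ≠ 0 := by positivity
    field_simp
    ring
  have e2 : entropyDeficit u = u * (log (1 + u) - log (1 - u)) - -log (1 - u ^ 2) := by
    rw [entropyDeficit, show 1 - u ^ 2 = (1 + u) * (1 - u) by ring,
      log_mul (by linarith) (by linarith)]
    ring
  rw [e1, e2]
  exact h

lemma tendsto_sum_entropyDeficit {T : Type*} [Fintype T] (w θ : T → ℝ) (d : ℝ) :
    Tendsto (fun s : ℝ => ∑ t, w t * entropyDeficit (s * d * θ t)) (𝓝[<] 1)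
      (𝓝 (∑ t, w t * entropyDeficit (d * θ t))) := by
  have : Continuous fun s : ℝ => ∑ t, w t * entropyDeficit (s * d * θ t) :=
    continuous_finsetSum _ fun t _ => continuous_const.mul
      (continuous_entropyDeficit.comp (by fun_prop))
  simpa using (this.tendsto 1).mono_left nhdsWithin_le_nhds

/-- Larger even moments of the biases mean a larger entropy deficit. -/
lemma sum_entropyDeficit_le {T T' : Type*} [Fintype T] [Fintype T'] {w θ : T → ℝ} {w' θ' : T' → ℝ}
    (hθ : ∀ t, |θ t| ≤ 1) (hθ' : ∀ t, |θ' t| ≤ 1)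
    (hmom : ∀ j : ℕ, ∑ t, w t * θ t ^ (2 * (j + 1)) ≤ ∑ t, w' t * θ' t ^ (2 * (j + 1)))
    {d : ℝ} (hd : |d| ≤ 1) :
    ∑ t, w t * entropyDeficit (d * θ t) ≤ ∑ t, w' t * entropyDeficit (d * θ' t) := by
  -- inside the open disc the power series can be compared term by term
  have hlt : ∀ c : ℝ, |c| < 1 →
      ∑ t, w t * entropyDeficit (c * θ t) ≤ ∑ t, w' t * entropyDeficit (c * θ' t) := by
    intro c hc
    have hs : ∀ {a : ℝ}, |a| ≤ 1 → |c * a| < 1 := fun {a} ha => by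
      rw [abs_mul]
      exact lt_of_le_of_lt (mul_le_of_le_one_right (abs_nonneg _) ha) hc
    have hl := hasSum_sum (s := Finset.univ) fun t _ =>
      (hasSum_entropyDeficit (hs (hθ t))).mul_left (w t)
    have hr := hasSum_sum (s := Finset.univ) fun t _ =>
      (hasSum_entropyDeficit (hs (hθ' t))).mul_left (w' t)
    refine hasSum_le (fun j => ?_) hl hr
    have hcoef : 0 ≤ (2 / (2 * (j : ℝ) + 1) - 1 / (j + 1)) * (c ^ (2 * (j + 1))) := by
      refine mul_nonneg ?_ ((even_two_mul _).pow_nonneg _)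
      rw [sub_nonneg, div_le_div_iff₀ (by positivity) (by positivity)]
      linarith
    have := mul_le_mul_of_nonneg_left (hmom j) hcoef
    simp only [Finset.mul_sum, mul_pow] at this ⊢
    refine le_trans (le_of_eq ?_) (this.trans (le_of_eq ?_)) <;>
      exact Finset.sum_congr rfl fun t _ => by ring
  refine le_of_tendsto_of_tendsto (tendsto_sum_entropyDeficit w θ d)
    (tendsto_sum_entropyDeficit w' θ' d) ?_
  filter_upwards [Ioo_mem_nhdsLT (show (0 : ℝ) < 1 by norm_num)] with s hs
  refine hlt _ ?_
  rw [abs_mul, abs_of_pos hs.1]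
  exact lt_of_le_of_lt (mul_le_of_le_one_right hs.1.le hd) hs.2

/-- Relative difference of the two rows of the channel. -/
def rowContrast (W : ZMod 2 → 𝒴 → ℝ) (z : 𝒴) : ℝ := (W 0 z - W 1 z) / (W 0 z + W 1 z)

lemma abs_rowContrast_le (hW : IsBISO W) (z : 𝒴) : |rowContrast W z| ≤ 1 := by
  have h0 := hW.nonneg 0 z
  have h1 := hW.nonneg 1 z
  rw [rowContrast, abs_div, abs_of_nonneg (add_nonneg h0 h1)]
  refine div_le_one_of_le₀ ?_ (add_nonneg h0 h1)
  rw [abs_le]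
  constructor <;> linarith

lemma mixedOutput_eq (hW : IsBISO W) (θ : ℝ) (z : 𝒴) :
    mixedOutput W θ z = mixedOutput W 0 z * (1 + rowContrast W z * θ) := by
  have h0 := hW.nonneg 0 z
  have h1 := hW.nonneg 1 z
  simp only [mixedOutput, rowContrast]
  by_cases h : W 0 z + W 1 z = 0
  · rw [show W 0 z = 0 by linarith, show W 1 z = 0 by linarith]
    simp
  · field_simp
    ring

/-- The information of a biased bit in terms of the entropy deficit: symmetrising over the two
rows removes the odd part. -/
lemma bitInfo_eq (hW : IsBISO W) (θ : ℝ) :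
    bitInfo W θ = bitInfo W 0 -
      ∑ z, mixedOutput W 0 z / 2 * entropyDeficit (rowContrast W z * θ) := by
  have h : bitInfo W θ = (bitInfo W θ + bitInfo W (-θ)) / 2 := by rw [bitInfo_neg hW]; ring
  have key : ∀ z, negMulLog (mixedOutput W θ z) + negMulLog (mixedOutput W (-θ) z) =
      negMulLog (mixedOutput W 0 z) * 2 -
        mixedOutput W 0 z * entropyDeficit (rowContrast W z * θ) := by
    intro z
    rw [mixedOutput_eq hW θ, mixedOutput_eq hW (-θ), negMulLog_mul, negMulLog_mul, entropyDeficit]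
    simp only [negMulLog]
    ring_nf
  have hs : bitInfo W θ + bitInfo W (-θ) = 2 * bitInfo W 0 -
      ∑ z, mixedOutput W 0 z * entropyDeficit (rowContrast W z * θ) := by
    have := Finset.sum_congr rfl fun z (_ : z ∈ Finset.univ) => key z
    rw [Finset.sum_add_distrib, Finset.sum_sub_distrib, ← Finset.sum_mul] at this
    simp only [bitInfo]
    linarith
  rw [h, hs]
  simp only [div_mul_eq_mul_div, ← Finset.sum_div]
  ring

lemma sum_bitInfo_eq (hW : IsBISO W) {T : Type*} [Fintype T] (w θ : T → ℝ) :
    ∑ t, w t * bitInfo W (θ t) = (∑ t, w t) * bitInfo W 0 -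
      ∑ z, mixedOutput W 0 z / 2 * ∑ t, w t * entropyDeficit (rowContrast W z * θ t) := by
  simp only [bitInfo_eq hW (θ _), mul_sub, Finset.sum_sub_distrib, Finset.sum_mul, Finset.mul_sum]
  rw [Finset.sum_comm]
  congr 1
  exact Finset.sum_congr rfl fun z _ => Finset.sum_congr rfl fun t _ => by ring

/-- Larger even moments of the biases mean less information. -/
lemma sum_bitInfo_le (hW : IsBISO W) {T T' : Type*} [Fintype T] [Fintype T'] {w θ : T → ℝ}
    {w' θ' : T' → ℝ} (hθ : ∀ t, |θ t| ≤ 1) (hθ' : ∀ t, |θ' t| ≤ 1) (hmass : ∑ t, w t = ∑ t, w' t)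
    (hmom : ∀ j : ℕ, ∑ t, w t * θ t ^ (2 * (j + 1)) ≤ ∑ t, w' t * θ' t ^ (2 * (j + 1))) :
    ∑ t, w' t * bitInfo W (θ' t) ≤ ∑ t, w t * bitInfo W (θ t) := by
  rw [sum_bitInfo_eq hW w' θ', sum_bitInfo_eq hW w θ, hmass]
  refine sub_le_sub_left (Finset.sum_le_sum fun z _ => mul_le_mul_of_nonneg_left
    (sum_entropyDeficit_le hθ hθ' hmom (abs_rowContrast_le hW z)) ?_) _
  exact div_nonneg (mixedOutput_nonneg hW (by simp) z) zero_le_two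

end Bit

/-! ### Adding one observation -/

section Increment

open Real

variable {𝒴 : Type*} [Fintype 𝒴] {W : ZMod 2 → 𝒴 → ℝ} {X E : Type*} [Fintype X]
  [Fintype E] [DecidableEq E]

/-- The conditional mean of the sign of the bit `v x` given the outputs `y`. Where `y` has
probability zero the value is `0`. -/
def bias (W : ZMod 2 → 𝒴 → ℝ) (u : E → X → ZMod 2) (y : E → 𝒴) (v : X → ZMod 2) : ℝ :=
  (∑ x, likelihood W u y x * bitSign (v x)) / ∑ x, likelihood W u y x

lemma abs_bias_le {E : Type*} [Fintype E] (hW : IsBISO W)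
    (u : E → X → ZMod 2) (y : E → 𝒴) (v : X → ZMod 2) :
    |bias W u y v| ≤ 1 := by
  have h0 : 0 ≤ ∑ x, likelihood W u y x :=
    Finset.sum_nonneg fun x _ => likelihood_nonneg hW u y x
  rw [bias, abs_div, abs_of_nonneg h0]
  refine div_le_one_of_le₀ ((Finset.abs_sum_le_sum_abs _ _).trans (le_of_eq ?_)) h0
  refine Finset.sum_congr rfl fun x _ => ?_
  rw [abs_mul, abs_bitSign, mul_one, abs_of_nonneg (likelihood_nonneg hW u y x)]

/-- The chain rule: a new observation contributes the conditional information that it carries about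
its bit, given the old outputs. -/
lemma familyInfo_option [Nonempty X] (hW : IsBISO W) (u : E → X → ZMod 2) (v : X → ZMod 2) :
    familyInfo W (fun e : Option E => e.elim v u) = familyInfo W u +
      (∑ y, outputLaw W u y * bitInfo W (bias W u y v)) / log 2 := by
  have hP : ∀ z : 𝒴, ∀ y : E → 𝒴,
      outputLaw W (fun e : Option E => e.elim v u) (fun e => e.elim z y) =
      outputLaw W u y * mixedOutput W (bias W u y v) z := by
    intro z y
    have h1 : ∀ x, likelihood W (fun e : Option E => e.elim v u) (fun e => e.elim z y) x =
        likelihood W u y x * ((W 0 z + W 1 z) / 2) +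
          likelihood W u y x * bitSign (v x) * ((W 0 z - W 1 z) / 2) := by
      intro x
      rw [likelihood, Fintype.prod_option]
      simp only [Option.elim_none, Option.elim_some]
      rw [channel_eq_mixedOutput (W := W) (v x) z, mixedOutput, ← likelihood]
      ring
    simp only [outputLaw, h1, Finset.sum_add_distrib, ← Finset.sum_mul]
    by_cases h0 : ∑ x, likelihood W u y x = 0
    · have h2 : ∀ x, likelihood W u y x = 0 := fun x =>
        (Finset.sum_eq_zero_iff_of_nonneg fun x _ => likelihood_nonneg hW u y x).1 h0 x
          (Finset.mem_univ x)
      simp [h2]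
    · rw [mixedOutput, bias]
      field_simp
      ring
  rw [familyInfo, familyInfo, ← add_div]
  congr 1
  rw [← Equiv.sum_comp (Equiv.piOptionEquivProd (β := fun _ : Option E => 𝒴)).symm,
    Fintype.sum_prod_type, Finset.sum_comm]
  have h2 : ∀ z : 𝒴, ∀ y : E → 𝒴,
      (Equiv.piOptionEquivProd (β := fun _ : Option E => 𝒴)).symm (z, y) =
        fun e => e.elim z y := by
    intro z y
    funext e
    cases e <;> rfl
  simp only [h2, hP, negMulLog_mul, Finset.sum_add_distrib, ← Finset.mul_sum, ← Finset.sum_mul,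
    sum_mixedOutput hW, Fintype.card_option, bitInfo, mul_sub, Finset.sum_sub_distrib,
    sum_outputLaw hW]
  push_cast
  ring

end Increment

/-! ### Information as a function of the multiset of observed bits -/

section Multiset

open Real

variable {𝒴 : Type*} [Fintype 𝒴] {W : ZMod 2 → 𝒴 → ℝ} {X X₁ X₂ : Type*} [Fintype X]
  [Fintype X₁] [Fintype X₂]

instance {α : Type*} [DecidableEq α] (s : Multiset α) : DecidableEq s.ToType :=
  inferInstanceAs (DecidableEq (Σ a : α, Fin (s.count a)))

/-- The mutual information, in bits, between a uniform `x` in `X` and the outputs of independent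
copies of `W` on the bits `u x`, where `u` runs through the multiset `s`. -/
def obsInfo (W : ZMod 2 → 𝒴 → ℝ) (s : Multiset (X → ZMod 2)) : ℝ :=
  familyInfo W (fun e : s.ToType => (e.1 : X → ZMod 2))

lemma familyInfo_eq_obsInfo {E : Type*} [Fintype E] [DecidableEq E] (u : E → X → ZMod 2) :
    familyInfo W u = obsInfo W (Finset.univ.val.map u) :=
  familyInfo_congr (by rw [Multiset.map_univ_coe])

lemma obsInfo_zero [Nonempty X] : obsInfo W (0 : Multiset (X → ZMod 2)) = 0 := by
  have h := familyInfo_eq_obsInfo (W := W) (fun (e : Empty) (_ : X) => (0 : ZMod 2))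
  rw [show Finset.univ.val.map (fun (e : Empty) (_ : X) => (0 : ZMod 2)) = 0 from rfl] at h
  rw [← h, familyInfo]
  have : (Fintype.card X : ℝ) ≠ 0 := by exact_mod_cast Fintype.card_ne_zero
  simp [outputLaw, likelihood, this]

lemma obsInfo_le [Nonempty X] (hW : IsBISO W) (s : Multiset (X → ZMod 2)) :
    obsInfo W s ≤ log (Fintype.card X) / log 2 :=
  familyInfo_le hW _

lemma univ_option_map_elim {α E : Type*} [Fintype E] (v : α) (u : E → α) :
    (Finset.univ : Finset (Option E)).val.map (fun e => e.elim v u) =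
      v ::ₘ Finset.univ.val.map u := by
  rw [univ_option, Finset.insertNone]
  simp [Function.comp_def]

/-- The increment of the information when the bit `v` is observed in addition to `s`. -/
lemma obsInfo_cons [Nonempty X] (hW : IsBISO W) (v : X → ZMod 2) (s : Multiset (X → ZMod 2)) :
    obsInfo W (v ::ₘ s) - obsInfo W s =
      (∑ y, outputLaw W (fun e : s.ToType => (e.1 : X → ZMod 2)) y *
        bitInfo W (bias W (fun e : s.ToType => (e.1 : X → ZMod 2)) y v)) / log 2 := by
  have h := familyInfo_option hW (fun e : s.ToType => (e.1 : X → ZMod 2)) v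
  rw [familyInfo_eq_obsInfo, ← obsInfo] at h
  rw [univ_option_map_elim, Multiset.map_univ_coe] at h
  rw [h]
  ring

lemma obsInfo_cons_nonneg [Nonempty X] (hW : IsBISO W) (v : X → ZMod 2)
    (s : Multiset (X → ZMod 2)) : 0 ≤ obsInfo W (v ::ₘ s) - obsInfo W s := by
  rw [obsInfo_cons hW]
  exact div_nonneg (Finset.sum_nonneg fun y _ => mul_nonneg (outputLaw_nonneg hW _ y)
    (bitInfo_nonneg hW (abs_bias_le hW _ y v))) (log_nonneg (by norm_num))

lemma obsInfo_cons_le [Nonempty X] (hW : IsBISO W) (v : X → ZMod 2)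
    (s : Multiset (X → ZMod 2)) : obsInfo W (v ::ₘ s) - obsInfo W s ≤ capacity W := by
  rw [obsInfo_cons hW, capacity_eq hW]
  refine div_le_div_of_nonneg_right ?_ (log_nonneg (by norm_num))
  refine (Finset.sum_le_sum fun y _ => mul_le_mul_of_nonneg_left
    (bitInfo_le_zero hW (abs_bias_le hW _ y v)) (outputLaw_nonneg hW _ y)).trans (le_of_eq ?_)
  rw [← Finset.sum_mul, sum_outputLaw hW, one_mul]

lemma obsInfo_nonneg [Nonempty X] (hW : IsBISO W) (s : Multiset (X → ZMod 2)) :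
    0 ≤ obsInfo W s := by
  induction s using Multiset.induction_on with
  | empty => exact obsInfo_zero.ge
  | cons v s ih => linarith [obsInfo_cons_nonneg hW v s]

/-- The information is additive over observations of independent components of `x`. -/
lemma obsInfo_prod [Nonempty X] (hW : IsBISO W) (p : X ≃ X₁ × X₂) (s : Multiset (X₁ → ZMod 2))
    (t : Multiset (X₂ → ZMod 2)) :
    obsInfo W (s.map (fun u x => u (p x).1) + t.map (fun u x => u (p x).2)) =
      obsInfo W s + obsInfo W t := by
  have h := familyInfo_prod hW p (fun e : s.ToType => (e.1 : X₁ → ZMod 2))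
    (fun e : t.ToType => (e.1 : X₂ → ZMod 2))
  rw [familyInfo_eq_obsInfo] at h
  rw [← obsInfo, ← obsInfo] at h
  rw [← h]
  congr 1
  rw [← Finset.univ_disjSum_univ, Finset.val_disjSum, Multiset.disjSum, Multiset.map_add,
    Multiset.map_map, Multiset.map_map]
  conv_lhs => rw [← Multiset.map_univ_coe s, ← Multiset.map_univ_coe t]
  rw [Multiset.map_map, Multiset.map_map]
  rfl

end Multiset

/-! ### The replica computation behind the interpolation inequality -/

section Replica

open Real

variable {𝒴 : Type*} [Fintype 𝒴] {W : ZMod 2 → 𝒴 → ℝ}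

/-- The parity of the bits of `x` at the entries of the tuple `t`, repetitions counted. -/
def tupleBit {ι : Type*} {k : ℕ} (t : Fin k → ι) (x : ι → ZMod 2) : ZMod 2 := ∑ l, x (t l)

/-- The `r`-th moments of the biases of random tuples, in terms of `r` replicas: the sum over tuples
factorises over the entries of the tuple. -/
lemma sum_tuple_moment {ι κ : Type*} [Fintype ι] [Fintype κ] [DecidableEq ι] (f : κ → ι)
    (p : (ι → ZMod 2) → ℝ) (k r : ℕ) :
    ∑ t : Fin k → κ, (∑ x, p x * bitSign (tupleBit (f ∘ t) x)) ^ r =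
      ∑ ξ : Fin r → ι → ZMod 2, (∏ s, p (ξ s)) * (∑ i, ∏ s, bitSign (ξ s (f i))) ^ k := by
  have h1 : ∀ t : Fin k → κ, (∑ x, p x * bitSign (tupleBit (f ∘ t) x)) ^ r =
      ∑ ξ : Fin r → ι → ZMod 2, (∏ s, p (ξ s)) * ∏ l, ∏ s, bitSign (ξ s (f (t l))) := by
    intro t
    rw [Fintype.sum_pow]
    refine Finset.sum_congr rfl fun ξ _ => ?_
    rw [Finset.prod_mul_distrib, Finset.prod_comm]
    simp only [tupleBit, bitSign_sum, Function.comp_apply]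
  simp only [h1]
  rw [Finset.sum_comm]
  refine Finset.sum_congr rfl fun ξ _ => ?_
  rw [← Finset.mul_sum, Fintype.sum_pow]

/-- Convexity of the even power `x ^ k`, in homogeneous form. -/
lemma mul_div_pow_le {k : ℕ} (hk : Even k) {a b : ℝ} (ha : 0 < a) (hb : 0 < b) (x y : ℝ) :
    (a + b) / (a + b) ^ k * (x + y) ^ k ≤ a / a ^ k * x ^ k + b / b ^ k * y ^ k := by
  have hab : 0 < a + b := by positivity
  have h := hk.convexOn_pow.2 (Set.mem_univ (x / a)) (Set.mem_univ (y / b))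
    (show 0 ≤ a / (a + b) by positivity) (show 0 ≤ b / (a + b) by positivity) (by field_simp)
  simp only [smul_eq_mul] at h
  have e : a / (a + b) * (x / a) + b / (a + b) * (y / b) = (x + y) / (a + b) := by
    field_simp
  rw [e, div_pow, div_pow, div_pow] at h
  have := mul_le_mul_of_nonneg_left h hab.le
  refine le_trans (le_of_eq ?_) (this.trans (le_of_eq ?_))
  · ring
  · field_simp

/-- The interpolation inequality: whatever has been observed before, a random tuple of vertices is
at least as informative as one drawn from the left block with probability `n₁ / (n₁ + n₂)` and from
the right block otherwise. -/
lemma sum_obsInfo_split_le (hW : IsBISO W) {k n₁ n₂ : ℕ} (hk : Even k) (h₁ : 0 < n₁) (h₂ : 0 < n₂)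
    (s : Multiset ((Fin (n₁ + n₂) → ZMod 2) → ZMod 2)) :
    ∑ t : Fin k → Fin n₁, (n₁ / n₁ ^ k : ℝ) *
        (obsInfo W (tupleBit (Fin.castAdd n₂ ∘ t) ::ₘ s) - obsInfo W s) +
      ∑ t : Fin k → Fin n₂, (n₂ / n₂ ^ k : ℝ) *
        (obsInfo W (tupleBit (Fin.natAdd n₁ ∘ t) ::ₘ s) - obsInfo W s) ≤
      ∑ t : Fin k → Fin (n₁ + n₂), ((n₁ + n₂ : ℕ) / (n₁ + n₂ : ℕ) ^ k : ℝ) *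
        (obsInfo W (tupleBit t ::ₘ s) - obsInfo W s) := by
  have hn₁ : (0 : ℝ) < n₁ := by exact_mod_cast h₁
  have hn₂ : (0 : ℝ) < n₂ := by exact_mod_cast h₂
  set u := fun e : s.ToType => (e.1 : (Fin (n₁ + n₂) → ZMod 2) → ZMod 2) with hu
  set w' : (Fin k → Fin n₁) ⊕ (Fin k → Fin n₂) → ℝ :=
    Sum.elim (fun _ => n₁ / n₁ ^ k) (fun _ => n₂ / n₂ ^ k) with hw'
  set v' : (Fin k → Fin n₁) ⊕ (Fin k → Fin n₂) → (Fin (n₁ + n₂) → ZMod 2) → ZMod 2 :=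
    Sum.elim (fun t => tupleBit (Fin.castAdd n₂ ∘ t)) (fun t => tupleBit (Fin.natAdd n₁ ∘ t))
    with hv'
  have key : ∀ y, ∑ t, w' t * bitInfo W (bias W u y (v' t)) ≤
      ∑ t : Fin k → Fin (n₁ + n₂), ((n₁ + n₂ : ℕ) / (n₁ + n₂ : ℕ) ^ k : ℝ) *
        bitInfo W (bias W u y (tupleBit t)) := by
    intro y
    refine sum_bitInfo_le hW (fun t => abs_bias_le hW _ _ _) (fun t => abs_bias_le hW _ _ _) ?_
      fun j => ?_
    · rw [Fintype.sum_sum_type]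
      simp only [hw', Sum.elim_inl, Sum.elim_inr, Finset.sum_const, Finset.card_univ,
        Fintype.card_pi, Fintype.card_fin, Finset.prod_const, nsmul_eq_mul]
      push_cast
      field_simp
    · rw [Fintype.sum_sum_type]
      simp only [hw', hv', Sum.elim_inl, Sum.elim_inr, bias, div_pow, ← Finset.mul_sum,
        ← Finset.sum_div]
      have h0 := sum_tuple_moment (id : Fin (n₁ + n₂) → Fin (n₁ + n₂)) (likelihood W u y) k
        (2 * (j + 1))
      simp only [Function.id_comp, id] at h0
      rw [h0, sum_tuple_moment, sum_tuple_moment, mul_div_assoc', mul_div_assoc', mul_div_assoc',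
        ← add_div]
      refine div_le_div_of_nonneg_right ?_ ((even_two_mul _).pow_nonneg _)
      simp only [Finset.mul_sum, ← Finset.sum_add_distrib]
      refine Finset.sum_le_sum fun ξ _ => ?_
      rw [Fin.sum_univ_add]
      have := mul_le_mul_of_nonneg_left (mul_div_pow_le hk hn₁ hn₂
        (∑ i, ∏ s, bitSign (ξ s (Fin.castAdd n₂ i))) (∑ i, ∏ s, bitSign (ξ s (Fin.natAdd n₁ i))))
        (Finset.prod_nonneg fun s (_ : s ∈ Finset.univ) => likelihood_nonneg hW u y (ξ s))
      push_cast
      linarith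
  have hsum : ∀ {T : Type} [Fintype T] (w : T → ℝ) (v : T → (Fin (n₁ + n₂) → ZMod 2) → ZMod 2),
      ∑ t, w t * (obsInfo W (v t ::ₘ s) - obsInfo W s) =
        (∑ y, outputLaw W u y * ∑ t, w t * bitInfo W (bias W u y (v t))) / log 2 := by
    intro T _ w v
    simp only [obsInfo_cons hW, mul_div_assoc', ← Finset.sum_div, Finset.mul_sum]
    rw [Finset.sum_comm]
    congr 1
    exact Finset.sum_congr rfl fun y _ => Finset.sum_congr rfl fun t _ => by ring
  have hl := hsum w' v'
  rw [Fintype.sum_sum_type] at hl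
  simp only [hw', hv', Sum.elim_inl, Sum.elim_inr] at hl
  rw [hl, hsum]
  exact div_le_div_of_nonneg_right (Finset.sum_le_sum fun y _ => mul_le_mul_of_nonneg_left (key y)
    (outputLaw_nonneg hW u y)) (log_nonneg (by norm_num))

end Replica

/-! ### Poisson superpositions as exponentials of shift operators -/

section Poisson

/-- The Banach space of bounded real functions on a discrete space, without its ring structure. -/
def BddFun (M : Type*) [TopologicalSpace M] : Type _ := M →ᵇ ℝ

instance (M : Type*) [TopologicalSpace M] : NormedAddCommGroup (BddFun M) :=
  inferInstanceAs (NormedAddCommGroup (M →ᵇ ℝ))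

instance (M : Type*) [TopologicalSpace M] : NormedSpace ℝ (BddFun M) :=
  inferInstanceAs (NormedSpace ℝ (M →ᵇ ℝ))

instance (M : Type*) [TopologicalSpace M] : CompleteSpace (BddFun M) :=
  inferInstanceAs (CompleteSpace (M →ᵇ ℝ))

instance (M : Type*) [TopologicalSpace M] : NormedAlgebra ℚ (BddFun M →L[ℝ] BddFun M) :=
  NormedAlgebra.restrictScalars ℚ ℝ _

instance (M : Type*) [TopologicalSpace M] : FunLike (BddFun M) M ℝ :=
  inferInstanceAs (FunLike (M →ᵇ ℝ) M ℝ)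

namespace BddFun

variable {M : Type*} [TopologicalSpace M]

@[ext] lemma ext {f g : BddFun M} (h : ∀ a, f a = g a) : f = g := DFunLike.ext _ _ h

@[simp] lemma add_apply (f g : BddFun M) (a : M) : (f + g) a = f a + g a := rfl

@[simp] lemma sub_apply (f g : BddFun M) (a : M) : (f - g) a = f a - g a := rfl

@[simp] lemma zero_apply (a : M) : (0 : BddFun M) a = 0 := rfl

@[simp] lemma smul_apply (c : ℝ) (f : BddFun M) (a : M) : (c • f) a = c * f a := rfl

/-- Evaluation at a point. -/
def eval (a : M) : BddFun M →L[ℝ] ℝ := BoundedContinuousFunction.evalCLM ℝ a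

@[simp] lemma eval_apply (a : M) (f : BddFun M) : eval a f = f a := rfl

@[simp] lemma sum_apply {T : Type*} (s : Finset T) (f : T → BddFun M) (a : M) :
    (∑ t ∈ s, f t) a = ∑ t ∈ s, f t a := map_sum (eval a) f s

/-- The constant function. -/
def const (M : Type*) [TopologicalSpace M] (c : ℝ) : BddFun M :=
  BoundedContinuousFunction.const M c

@[simp] lemma const_apply (c : ℝ) (a : M) : const M c a = c := rfl

/-- A function with values in `[-c, c]`. -/
def ofBound [DiscreteTopology M] (f : M → ℝ) (c : ℝ) (h : ∀ a, ‖f a‖ ≤ c) : BddFun M :=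
  BoundedContinuousFunction.ofNormedAddCommGroupDiscrete f c h

@[simp] lemma ofBound_apply [DiscreteTopology M] (f : M → ℝ) (c : ℝ) (h : ∀ a, ‖f a‖ ≤ c)
    (a : M) : ofBound f c h a = f a := rfl

lemma abs_le_norm (f : BddFun M) (a : M) : |f a| ≤ ‖f‖ :=
  BoundedContinuousFunction.norm_coe_le_norm (f : M →ᵇ ℝ) a

end BddFun

variable {M M' : Type*} [AddCommMonoid M] [TopologicalSpace M] [DiscreteTopology M]
  [AddCommMonoid M'] [TopologicalSpace M'] [DiscreteTopology M'] {T T' : Type*} [Fintype T]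
  [Fintype T']

/-- The operator `f ↦ f (· + b)` on bounded functions. -/
def shiftOp (b : M) : BddFun M →L[ℝ] BddFun M :=
  BoundedContinuousFunction.compContinuousCLM ℝ ℝ ⟨fun a => a + b, continuous_of_discreteTopology⟩

@[simp] lemma shiftOp_apply (b : M) (f : BddFun M) (a : M) : shiftOp b f a = f (a + b) := rfl

/-- The generator of the Markov semigroup that adds `s t` to the configuration at rate `w t`. -/
def poissonGen (w : T → ℝ) (s : T → M) : BddFun M →L[ℝ] BddFun M :=
  ∑ t, w t • (shiftOp (s t) - 1)

/-- The Markov semigroup at time one: `poissonOp w s f a` is the mean of `f` at `a` plus the sum of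
independent `Poisson (w t)` many copies of `s t`. -/
def poissonOp (w : T → ℝ) (s : T → M) : BddFun M →L[ℝ] BddFun M :=
  NormedSpace.exp (poissonGen w s)

lemma poissonGen_apply (w : T → ℝ) (s : T → M) (f : BddFun M) (a : M) :
    poissonGen w s f a = ∑ t, w t * (f (a + s t) - f a) := by
  simp [poissonGen]

lemma commute_shiftOp (b c : M) : Commute (shiftOp b) (shiftOp c) := by
  ext f a
  simp only [mul_apply_eq_comp, shiftOp_apply]
  rw [add_assoc, add_assoc, add_comm b c]

lemma commute_poissonGen (w : T → ℝ) (s : T → M) (w' : T' → ℝ) (s' : T' → M) :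
    Commute (poissonGen w s) (poissonGen w' s') := by
  refine Commute.sum_left _ _ _ fun t _ => Commute.sum_right _ _ _ fun t' _ => ?_
  exact ((((commute_shiftOp _ _).sub_left (Commute.one_left _)).sub_right
    (Commute.one_right _)).smul_left _).smul_right _

/-- Evaluation of the exponential series of an operator. -/
lemma hasSum_exp_apply {M : Type*} [TopologicalSpace M]
    (G : BddFun M →L[ℝ] BddFun M) (f : BddFun M) (a : M) :
    HasSum (fun m : ℕ => (m.factorial : ℝ)⁻¹ * (G ^ m) f a) (NormedSpace.exp G f a) := by
  have h := NormedSpace.exp_series_hasSum_exp' (𝕂 := ℝ) G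
  exact h.mapL ((BddFun.eval a).comp (ContinuousLinearMap.apply ℝ _ f))

lemma exp_add_smul_one {M : Type*} [TopologicalSpace M] (G : BddFun M →L[ℝ] BddFun M) (c : ℝ) :
    NormedSpace.exp (G + c • (1 : BddFun M →L[ℝ] BddFun M)) =
      Real.exp c • NormedSpace.exp G := by
  rw [NormedSpace.exp_add_of_commute ((Commute.one_right G).smul_right _),
    ← Algebra.algebraMap_eq_smul_one, ← NormedSpace.algebraMap_exp_comm,
    Algebra.algebraMap_eq_smul_one, ← Real.exp_eq_exp_ℝ, mul_smul_comm, mul_one]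

lemma poissonOp_nonneg {w : T → ℝ} (hw : ∀ t, 0 ≤ w t) (s : T → M) {f : BddFun M}
    (hf : ∀ a, 0 ≤ f a) (a : M) : 0 ≤ poissonOp w s f a := by
  -- up to a positive scalar the exponential is that of an operator with nonnegative coefficients
  set L : BddFun M →L[ℝ] BddFun M := ∑ t, w t • shiftOp (s t) with hL
  have hG : poissonGen w s = L + (-(∑ t, w t)) • (1 : BddFun M →L[ℝ] BddFun M) := by
    simp only [poissonGen, smul_sub, Finset.sum_sub_distrib, hL, neg_smul, Finset.sum_smul]
    abel
  have hpow : ∀ (m : ℕ) (a : M), 0 ≤ (L ^ m) f a := by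
    intro m
    induction m with
    | zero => exact hf
    | succ m ih =>
      intro a
      rw [pow_succ', mul_apply_eq_comp, hL]
      simp only [_root_.sum_apply, BddFun.sum_apply, _root_.smul_apply, BddFun.smul_apply,
        shiftOp_apply]
      exact Finset.sum_nonneg fun t _ => mul_nonneg (hw t) (ih _)
  rw [poissonOp, hG, exp_add_smul_one]
  rw [_root_.smul_apply, BddFun.smul_apply]
  refine mul_nonneg (Real.exp_nonneg _) ((hasSum_exp_apply L f a).nonneg fun m => ?_)
  exact mul_nonneg (by positivity) (hpow m a)

lemma exp_apply_eq_self {M : Type*} [TopologicalSpace M]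
    {G : BddFun M →L[ℝ] BddFun M} {f : BddFun M} (h : G f = 0) :
    NormedSpace.exp G f = f := by
  ext a
  refine (hasSum_exp_apply G f a).unique ?_
  have : ∀ m : ℕ, m ≠ 0 → (m.factorial : ℝ)⁻¹ * (G ^ m) f a = 0 := by
    intro m hm
    obtain ⟨m, rfl⟩ := Nat.exists_eq_succ_of_ne_zero hm
    rw [pow_succ, mul_apply_eq_comp, h, map_zero]
    simp
  simpa using hasSum_single (f := fun m : ℕ => (m.factorial : ℝ)⁻¹ * (G ^ m) f a) 0 this

lemma poissonOp_const (w : T → ℝ) (s : T → M) (c : ℝ) :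
    poissonOp w s (BddFun.const M c) = BddFun.const M c := by
  refine exp_apply_eq_self ?_
  ext a
  simp [poissonGen_apply]

lemma poissonOp_le {w : T → ℝ} (hw : ∀ t, 0 ≤ w t) (s : T → M) {f : BddFun M} {c : ℝ}
    (hf : ∀ a, f a ≤ c) (a : M) : poissonOp w s f a ≤ c := by
  have h := poissonOp_nonneg hw s (f := BddFun.const M c - f)
    (fun a => by simpa using hf a) a
  rw [map_sub, poissonOp_const] at h
  simpa using h

/-- Comparison of two Poisson superpositions through their generators. Along the segment between
the two generators the derivative of the mean is the mean of the difference of the generators. -/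
lemma poissonOp_le_add {w : T → ℝ} {w' : T' → ℝ} (hw : ∀ t, 0 ≤ w t) (hw' : ∀ t, 0 ≤ w' t)
    (s : T → M) (s' : T' → M) {f : BddFun M} {ε : ℝ}
    (h : ∀ a, ∑ t, w' t * (f (a + s' t) - f a) ≤ ∑ t, w t * (f (a + s t) - f a) + ε) (a : M) :
    poissonOp w' s' f a ≤ poissonOp w s f a + ε := by
  set G := poissonGen w s with hG
  set G' := poissonGen w' s' with hG'
  have hcomm : Commute G G' := commute_poissonGen _ _ _ _
  have hcommH : Commute (G' - G) G := hcomm.symm.sub_left (Commute.refl G)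
  have hder : ∀ r : ℝ, HasDerivAt
      (fun r : ℝ => NormedSpace.exp (r • (G' - G)) (NormedSpace.exp G f) a)
      ((NormedSpace.exp (r • (G' - G)) * (G' - G)) (NormedSpace.exp G f) a) r := by
    intro r
    exact ((BddFun.eval a).comp
      (ContinuousLinearMap.apply ℝ _ (NormedSpace.exp G f))).hasFDerivAt.comp_hasDerivAt r
      (hasDerivAt_exp_smul_const (G' - G) r)
  have hbound : ∀ r ∈ Set.Ico (0 : ℝ) 1,
      (NormedSpace.exp (r • (G' - G)) * (G' - G)) (NormedSpace.exp G f) a ≤ ε := by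
    intro r hr
    have hmix : r • (G' - G) + G = poissonGen (Sum.elim (fun t => (1 - r) * w t) fun t => r * w' t)
        (Sum.elim s s') := by
      rw [hG, hG', poissonGen, poissonGen, poissonGen, Fintype.sum_sum_type]
      simp only [Sum.elim_inl, Sum.elim_inr, mul_smul, ← Finset.smul_sum]
      module
    have hfac : (NormedSpace.exp (r • (G' - G)) * (G' - G)) (NormedSpace.exp G f) =
        poissonOp (Sum.elim (fun t => (1 - r) * w t) fun t => r * w' t) (Sum.elim s s')
          ((G' - G) f) := by
      rw [poissonOp, ← hmix, NormedSpace.exp_add_of_commute (hcommH.smul_left r)]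
      have : (G' - G) * NormedSpace.exp G = NormedSpace.exp G * (G' - G) :=
        (hcommH.exp_right)
      rw [← mul_apply_eq_comp, mul_assoc, this, ← mul_assoc,
        mul_apply_eq_comp]
    rw [hfac]
    refine poissonOp_le (fun t => ?_) _ (fun b => ?_) a
    · cases t with
      | inl t => exact mul_nonneg (by linarith [hr.2]) (hw t)
      | inr t => exact mul_nonneg hr.1 (hw' t)
    · rw [_root_.sub_apply, BddFun.sub_apply, hG, hG',
        poissonGen_apply, poissonGen_apply]
      linarith [h b]
  have := image_le_of_deriv_right_le_deriv_boundary
    (f := fun r : ℝ => NormedSpace.exp (r • (G' - G)) (NormedSpace.exp G f) a)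
    (B := fun r : ℝ => NormedSpace.exp G f a + ε * r) (B' := fun _ => ε) (a := 0) (b := 1)
    (fun r _ => (hder r).continuousAt.continuousWithinAt) (fun r _ => (hder r).hasDerivWithinAt)
    (by simp) (by fun_prop)
    (fun r _ => by
      simpa only [mul_one, id] using
        (((hasDerivAt_id r).const_mul ε).const_add (NormedSpace.exp G f a)).hasDerivWithinAt)
    hbound (Set.right_mem_Icc.2 zero_le_one)
  have hend : NormedSpace.exp ((1 : ℝ) • (G' - G)) (NormedSpace.exp G f) = NormedSpace.exp G' f := by
    rw [one_smul, ← mul_apply_eq_comp, ← NormedSpace.exp_add_of_commute hcommH,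
      sub_add_cancel]
  simp only [hend, mul_one] at this
  exact this

/-- A Poisson superposition on `M'` that is the image of one on `M`. -/
lemma poissonOp_map (w : T → ℝ) {s : T → M} {s' : T → M'} {φ : M → M'}
    (hφ : ∀ a t, φ (a + s t) = φ a + s' t) {f : BddFun M'} {g : BddFun M} (hg : ∀ a, g a = f (φ a))
    (a : M) : poissonOp w s' f (φ a) = poissonOp w s g a := by
  have hpow : ∀ (m : ℕ) (a : M), (poissonGen w s' ^ m) f (φ a) = (poissonGen w s ^ m) g a := by
    intro m
    induction m with
    | zero => exact fun a => (hg a).symm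
    | succ m ih =>
      intro a
      rw [pow_succ', pow_succ', mul_apply_eq_comp, mul_apply_eq_comp,
        poissonGen_apply, poissonGen_apply]
      simp only [← hφ, ih]
  refine (hasSum_exp_apply _ f (φ a)).unique ?_
  simp only [hpow]
  exact hasSum_exp_apply _ g a

/-- Independent superpositions compose. -/
lemma poissonOp_sum (w : T → ℝ) (w' : T' → ℝ) (s : T → M) (s' : T' → M) (f : BddFun M) :
    poissonOp (Sum.elim w w') (Sum.elim s s') f = poissonOp w s (poissonOp w' s' f) := by
  rw [poissonOp, poissonOp, poissonOp, ← mul_apply_eq_comp,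
    ← NormedSpace.exp_add_of_commute (commute_poissonGen _ _ _ _)]
  congr 3
  rw [poissonGen, poissonGen, poissonGen, Fintype.sum_sum_type]
  rfl

end Poisson

/-! ### Functions of independent multiplicities -/

section ProductLaw

variable {T : Type*} [Fintype T] [DecidableEq T]

lemma integrable_of_abs_le {Ω : Type*} [MeasurableSpace Ω] [DiscreteMeasurableSpace Ω] [Countable Ω]
    (μ : Measure Ω) [IsFiniteMeasure μ] {f : Ω → ℝ} {B : ℝ} (hf : ∀ a, |f a| ≤ B) :
    Integrable f μ :=
  Integrable.of_bound (Measurable.of_discrete).aestronglyMeasurable B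
    (ae_of_all _ fun a => (Real.norm_eq_abs _).trans_le (hf a))

lemma abs_integral_le {Ω : Type*} [MeasurableSpace Ω] (μ : Measure Ω) [IsProbabilityMeasure μ]
    {f : Ω → ℝ} {B : ℝ} (hf : ∀ a, |f a| ≤ B) : |∫ a, f a ∂μ| ≤ B := by
  simpa using norm_integral_le_of_norm_le_const (μ := μ) 
    (ae_of_all _ fun a => (Real.norm_eq_abs _).trans_le (hf a))

/-- Resampling one coordinate of a product law. -/
lemma pi_update_eq_map (ν : T → Measure ℕ) [∀ t, IsProbabilityMeasure (ν t)] (t : T)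
    (ρ : Measure ℕ) [IsProbabilityMeasure ρ] :
    Measure.pi (Function.update ν t ρ) =
      ((Measure.pi ν).prod ρ).map fun q => Function.update q.1 t q.2 := by
  have : ∀ t', IsProbabilityMeasure (Function.update ν t ρ t') := by
    intro t'
    by_cases h : t' = t
    · subst h
      rwa [Function.update_self]
    · rw [Function.update_of_ne h]
      infer_instance
  refine Measure.pi_eq fun s _ => ?_
  rw [Measure.map_apply Measurable.of_discrete (MeasurableSet.of_discrete)]
  have hpre : (fun q : (T → ℕ) × ℕ => Function.update q.1 t q.2) ⁻¹' (Set.univ.pi s) =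
      (Set.univ.pi (Function.update s t Set.univ)) ×ˢ (s t) := by
    ext ⟨c, j⟩
    simp only [Set.mem_preimage, Set.mem_univ_pi, Set.mem_prod]
    constructor
    · intro h
      refine ⟨fun t' => ?_, by simpa using h t⟩
      by_cases ht : t' = t
      · subst ht
        simp
      · simpa [Function.update_of_ne ht] using h t'
    · rintro ⟨h1, h2⟩ t'
      by_cases ht : t' = t
      · subst ht
        simpa using h2
      · simpa [Function.update_of_ne ht] using h1 t'
  rw [hpre, Measure.prod_prod, Measure.pi_pi, ← Finset.prod_erase_mul _ _ (Finset.mem_univ t),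
    ← Finset.prod_erase_mul _ (fun t' => Function.update ν t ρ t' (s t')) (Finset.mem_univ t)]
  simp only [Function.update_self, measure_univ, mul_one]
  congr 1
  refine Finset.prod_congr rfl fun t' ht' => ?_
  rw [Function.update_of_ne (Finset.ne_of_mem_erase ht'),
    Function.update_of_ne (Finset.ne_of_mem_erase ht')]

lemma integral_pi_update (ν : T → Measure ℕ) [∀ t, IsProbabilityMeasure (ν t)] (t : T)
    (ρ : Measure ℕ) [IsProbabilityMeasure ρ] {f : (T → ℕ) → ℝ} {B : ℝ} (hf : ∀ c, |f c| ≤ B) :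
    ∫ c, f c ∂Measure.pi (Function.update ν t ρ) =
      ∫ c, ∫ j, f (Function.update c t j) ∂ρ ∂Measure.pi ν := by
  rw [pi_update_eq_map, integral_map Measurable.of_discrete.aemeasurable
    Measurable.of_discrete.aestronglyMeasurable, integral_prod]
  exact integrable_of_abs_le _ fun _ => hf _

lemma insert_piecewise_eq_update {T : Type*} [DecidableEq T] {S : Finset T} {t : T} (ν ν' : T → Measure ℕ) :
    (insert t S).piecewise ν ν' = Function.update (S.piecewise ν ν') t (ν t) :=
  Finset.piecewise_insert _ _ _ _

lemma isProbabilityMeasure_piecewise {T : Type*} [DecidableEq T] (S : Finset T) (ν ν' : T → Measure ℕ)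
    [∀ t, IsProbabilityMeasure (ν t)] [∀ t, IsProbabilityMeasure (ν' t)] (t : T) :
    IsProbabilityMeasure (S.piecewise ν ν' t) := by
  by_cases h : t ∈ S
  · rw [Finset.piecewise_eq_of_mem _ _ _ h]
    infer_instance
  · rw [Finset.piecewise_eq_of_notMem _ _ _ h]
    infer_instance

/-- A function of the multiplicities which changes by at most `j` when `j` copies of an edge are
removed. -/
def IsEdgeLipschitz {T : Type*} [DecidableEq T] (f : (T → ℕ) → ℝ) : Prop :=
  ∀ c t j, |f (Function.update c t j) - f (Function.update c t 0)| ≤ j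

lemma IsEdgeLipschitz.integral_update {T : Type*} [DecidableEq T] {f : (T → ℕ) → ℝ} {B : ℝ}
    (hL : IsEdgeLipschitz f)
    (hf : ∀ c, |f c| ≤ B) (t : T) (ρ : Measure ℕ) [IsProbabilityMeasure ρ] :
    IsEdgeLipschitz fun c => ∫ j, f (Function.update c t j) ∂ρ := by
  intro c t' j
  by_cases ht : t' = t
  · subst ht
    simp
  · rw [← integral_sub (integrable_of_abs_le _ fun _ => hf _)
      (integrable_of_abs_le _ fun _ => hf _)]
    refine abs_integral_le _ fun i => ?_
    rw [Function.update_comm ht, Function.update_comm ht]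
    exact hL _ _ _

lemma integral_sq_le_of_lipschitz {ρ : Measure ℕ} [IsProbabilityMeasure ρ] {h : ℕ → ℝ} {B : ℝ}
    (hB : ∀ j, |h j| ≤ B) (hL : ∀ j, |h j - h 0| ≤ j)
    (hint : Integrable (fun j : ℕ => (j : ℝ) ^ 2) ρ) :
    ∫ j, h j ^ 2 ∂ρ ≤ (∫ j, h j ∂ρ) ^ 2 + ∫ j : ℕ, (j : ℝ) ^ 2 ∂ρ := by
  have hB0 : 0 ≤ B := (abs_nonneg _).trans (hB 0)
  have hi : Integrable h ρ := integrable_of_abs_le _ hB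
  have hi2 : Integrable (fun j => h j ^ 2) ρ := integrable_of_abs_le _ (B := B ^ 2) fun j => by
    rw [abs_pow]
    exact pow_le_pow_left₀ (abs_nonneg _) (hB j) 2
  have hi3 : Integrable (fun j => h j ^ 2 - 2 * h 0 * h j) ρ := hi2.sub (hi.const_mul _)
  have hmono : ∫ j, (h j ^ 2 - 2 * h 0 * h j + h 0 ^ 2) ∂ρ ≤ ∫ j : ℕ, (j : ℝ) ^ 2 ∂ρ := by
    refine integral_mono (hi3.add (integrable_const _)) hint fun j => ?_
    have := pow_le_pow_left₀ (abs_nonneg _) (hL j) 2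
    rw [sq_abs] at this
    simp only
    linarith
  rw [integral_add hi3 (integrable_const _),
    integral_sub hi2 (hi.const_mul _), integral_const_mul] at hmono
  simp only [integral_const, probReal_univ, one_smul] at hmono
  nlinarith [sq_nonneg (∫ j, h j ∂ρ - h 0)]

/-- The Efron–Stein bound: the variance of an edge-Lipschitz function is at most the sum of the
second moments of the multiplicities. -/
lemma integral_sq_sub_le (ν : T → Measure ℕ) [∀ t, IsProbabilityMeasure (ν t)]
    (hint : ∀ t, Integrable (fun j : ℕ => (j : ℝ) ^ 2) (ν t)) {f : (T → ℕ) → ℝ} {B : ℝ}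
    (hB : ∀ c, |f c| ≤ B) (hL : IsEdgeLipschitz f) :
    ∫ c, f c ^ 2 ∂Measure.pi ν - (∫ c, f c ∂Measure.pi ν) ^ 2 ≤
      ∑ t, ∫ j : ℕ, (j : ℝ) ^ 2 ∂ν t := by
  -- induction on the set `S` of random coordinates, those outside `S` being frozen at `0`
  have key : ∀ (S : Finset T) (f : (T → ℕ) → ℝ), (∀ c, |f c| ≤ B) → IsEdgeLipschitz f →
      ∫ c, f c ^ 2 ∂Measure.pi (S.piecewise ν fun _ => Measure.dirac 0) -
        (∫ c, f c ∂Measure.pi (S.piecewise ν fun _ => Measure.dirac 0)) ^ 2 ≤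
      ∑ t ∈ S, ∫ j : ℕ, (j : ℝ) ^ 2 ∂ν t := by
    intro S
    induction S using Finset.induction_on with
    | empty =>
      intro f _ _
      have : Measure.pi (fun _ : T => Measure.dirac (0 : ℕ)) = Measure.dirac 0 := by
        refine Measure.pi_eq fun s _ => ?_
        by_cases h : ∀ i, (0 : ℕ) ∈ s i
        · rw [Measure.dirac_apply_of_mem (show (0 : T → ℕ) ∈ Set.univ.pi s from Set.mem_univ_pi.2 h)]
          simp [Measure.dirac_apply_of_mem (h _)]
        · obtain ⟨i, hi⟩ := not_forall.1 h
          rw [Finset.prod_eq_zero (Finset.mem_univ i) (by simp [hi])]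
          simpa using ⟨i, hi⟩
      simp [Finset.piecewise_empty, this]
    | insert t S ht ih =>
      intro f hB hL
      have hP := isProbabilityMeasure_piecewise S ν (fun _ => Measure.dirac 0)
      have hB2 : ∀ c, |f c ^ 2| ≤ B ^ 2 := fun c => by
        rw [abs_pow]
        exact pow_le_pow_left₀ (abs_nonneg _) (hB c) 2
      rw [insert_piecewise_eq_update, integral_pi_update _ _ _ hB, integral_pi_update _ _ _ hB2,
        Finset.sum_insert ht]
      have hgB : ∀ c, |∫ j, f (Function.update c t j) ∂ν t| ≤ B :=
        fun c => abs_integral_le _ fun j => hB _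
      have h1 := ih _ hgB (hL.integral_update hB t (ν t))
      have h2 : ∫ c, ∫ j, f (Function.update c t j) ^ 2 ∂ν t
            ∂Measure.pi (S.piecewise ν fun _ => Measure.dirac 0) ≤
          ∫ c, ((∫ j, f (Function.update c t j) ∂ν t) ^ 2 + ∫ j : ℕ, (j : ℝ) ^ 2 ∂ν t)
            ∂Measure.pi (S.piecewise ν fun _ => Measure.dirac 0) := by
        have hgi : Integrable (fun c => (∫ j, f (Function.update c t j) ∂ν t) ^ 2)
            (Measure.pi (S.piecewise ν fun _ => Measure.dirac 0)) :=
          integrable_of_abs_le _ (B := B ^ 2) fun c => by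
            rw [abs_pow]
            exact pow_le_pow_left₀ (abs_nonneg _) (hgB c) 2
        refine integral_mono (integrable_of_abs_le _ (B := B ^ 2) fun c =>
          abs_integral_le _ fun j => hB2 _) (hgi.add (integrable_const _)) fun c => ?_
        exact integral_sq_le_of_lipschitz (fun j => hB _) (fun j => hL c t j) (hint t)
      rw [integral_add (integrable_of_abs_le _ (B := B ^ 2) fun c => by
        rw [abs_pow]
        exact pow_le_pow_left₀ (abs_nonneg _) (hgB c) 2) (integrable_const _)] at h2
      simp only [integral_const, probReal_univ, one_smul] at h2
      linarith
  have := key Finset.univ f hB hL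
  rwa [Finset.piecewise_univ] at this

/-- Replacing the law of every coordinate, one coordinate at a time. -/
lemma abs_integral_pi_sub_le (ν ν' : T → Measure ℕ) [∀ t, IsProbabilityMeasure (ν t)]
    [∀ t, IsProbabilityMeasure (ν' t)] {ε B : ℝ}
    (hε : ∀ t, ∀ h : ℕ → ℝ, (∀ j, |h j| ≤ B) → (∀ j : ℕ, |h j - h 0| ≤ j) →
      |∫ j, h j ∂ν' t - ∫ j, h j ∂ν t| ≤ ε)
    {f : (T → ℕ) → ℝ} (hB : ∀ c, |f c| ≤ B) (hL : IsEdgeLipschitz f) :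
    |∫ c, f c ∂Measure.pi ν' - ∫ c, f c ∂Measure.pi ν| ≤ Fintype.card T * ε := by
  have key : ∀ S : Finset T, |∫ c, f c ∂Measure.pi (S.piecewise ν' ν) - ∫ c, f c ∂Measure.pi ν| ≤
      S.card * ε := by
    intro S
    induction S using Finset.induction_on with
    | empty => simp [Finset.piecewise_empty]
    | insert t S ht ih =>
      have hP := isProbabilityMeasure_piecewise S ν' ν
      have hself : S.piecewise ν' ν = Function.update (S.piecewise ν' ν) t (ν t) := by
        rw [← Finset.piecewise_eq_of_notMem _ ν' ν ht, Function.update_eq_self]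
      have hstep : |∫ c, f c ∂Measure.pi ((insert t S).piecewise ν' ν) -
          ∫ c, f c ∂Measure.pi (S.piecewise ν' ν)| ≤ ε := by
        rw [insert_piecewise_eq_update, integral_pi_update _ _ _ hB]
        conv_lhs =>
          enter [1, 2]
          rw [hself, integral_pi_update _ _ _ hB]
        rw [← integral_sub (integrable_of_abs_le _ fun c => abs_integral_le _ fun j => hB _)
          (integrable_of_abs_le _ fun c => abs_integral_le _ fun j => hB _)]
        exact abs_integral_le _ fun c => hε t _ (fun j => hB _) fun j => hL c t j
      rw [Finset.card_insert_of_notMem ht]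
      push_cast
      have := abs_sub_le (∫ c, f c ∂Measure.pi ((insert t S).piecewise ν' ν))
        (∫ c, f c ∂Measure.pi (S.piecewise ν' ν)) (∫ c, f c ∂Measure.pi ν)
      linarith
  have := key Finset.univ
  rwa [Finset.piecewise_univ, Finset.card_univ] at this

end ProductLaw

/-! ### The laws of the multiplicities -/

section EdgeLaw

/-- The first two factorial moments of the Poisson law. -/
lemma poissonMeasure_factorial_moments (r : ℝ≥0) :
    Integrable (fun j : ℕ => (j : ℝ)) (poissonMeasure r) ∧ ∫ j : ℕ, (j : ℝ) ∂poissonMeasure r = r ∧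
    Integrable (fun j : ℕ => (j : ℝ) * (j - 1)) (poissonMeasure r) ∧
    ∫ j : ℕ, (j : ℝ) * (j - 1) ∂poissonMeasure r = r ^ 2 := by
  have h0 := hasSum_one_poissonMeasure r
  have h1 : HasSum (fun j : ℕ => Real.exp (-r) * r ^ j / j.factorial * (j : ℝ)) r := by
    rw [← hasSum_nat_add_iff' 1]
    simp only [Finset.sum_range_one, Nat.cast_zero, mul_zero, sub_zero]
    convert! h0.mul_left (r : ℝ) using 1
    · funext j
      rw [Nat.factorial_succ]
      push_cast
      field_simp
      ring
    · rw [mul_one]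
  have h2 : HasSum (fun j : ℕ => Real.exp (-r) * r ^ j / j.factorial * ((j : ℝ) * (j - 1)))
      ((r : ℝ) ^ 2) := by
    rw [← hasSum_nat_add_iff' 2]
    simp only [Finset.sum_range_succ, Finset.sum_range_zero, Nat.cast_zero, Nat.cast_one, zero_mul,
      sub_self, mul_zero, add_zero, sub_zero]
    convert! h0.mul_left ((r : ℝ) ^ 2) using 1
    · funext j
      rw [Nat.factorial_succ, Nat.factorial_succ]
      push_cast
      field_simp
      ring
    · rw [mul_one]
  have i1 : Integrable (fun j : ℕ => (j : ℝ)) (poissonMeasure r) := by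
    rw [integrable_poissonMeasure_iff]
    simpa using h1.summable
  have i2 : Integrable (fun j : ℕ => (j : ℝ) * (j - 1)) (poissonMeasure r) := by
    rw [integrable_poissonMeasure_iff]
    refine h2.summable.congr fun j => ?_
    rw [Real.norm_of_nonneg]
    rcases j with _ | j
    · simp
    · push_cast
      nlinarith [(Nat.cast_nonneg j : (0 : ℝ) ≤ j)]
  refine ⟨i1, ?_, i2, ?_⟩
  · exact (hasSum_integral_poissonMeasure i1).unique (by simpa only [smul_eq_mul] using h1)
  · exact (hasSum_integral_poissonMeasure i2).unique (by simpa only [smul_eq_mul] using h2)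

instance (M : Model) (p : ℝ≥0) : IsProbabilityMeasure (M.edgeLaw p) := by
  cases M
  · exact inferInstanceAs (IsProbabilityMeasure (poissonMeasure p))
  · exact inferInstanceAs (IsProbabilityMeasure (bernoulliMeasure 1 0 _))

lemma integral_erdosRenyi (p : ℝ≥0) (h : ℕ → ℝ) :
    ∫ j, h j ∂Model.edgeLaw .erdosRenyi p = (min p 1 : ℝ≥0) * h 1 + (1 - (min p 1 : ℝ≥0)) * h 0 := by
  rw [Model.edgeLaw, integral_bernoulliMeasure]
  rfl

lemma integrable_sq_edgeLaw (M : Model) (p : ℝ≥0) :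
    Integrable (fun j : ℕ => (j : ℝ) ^ 2) (M.edgeLaw p) := by
  cases M
  · obtain ⟨i1, -, i2, -⟩ := poissonMeasure_factorial_moments p
    refine (i2.add i1).congr (ae_of_all _ fun j => ?_)
    simp only [Pi.add_apply]
    ring
  · exact integrable_bernoulliMeasure _ _ _ _

lemma integral_sq_edgeLaw_le (M : Model) (p : ℝ≥0) :
    ∫ j : ℕ, (j : ℝ) ^ 2 ∂M.edgeLaw p ≤ p + p ^ 2 := by
  cases M
  · obtain ⟨i1, e1, i2, e2⟩ := poissonMeasure_factorial_moments p
    refine le_of_eq ?_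
    have h := integral_add i1 i2
    rw [e1, e2] at h
    rw [← h, Model.edgeLaw]
    exact integral_congr_ae (ae_of_all _ fun j => by ring)
  · rw [integral_erdosRenyi]
    have : ((min p 1 : ℝ≥0) : ℝ) ≤ p := by exact_mod_cast min_le_left p 1
    simp only [Nat.cast_one, Nat.cast_zero]
    nlinarith [sq_nonneg (p : ℝ)]

lemma integral_edgeLaw (M : Model) {p : ℝ≥0} (hp : p ≤ 1) :
    ∫ j : ℕ, (j : ℝ) ∂M.edgeLaw p = p := by
  cases M
  · exact (poissonMeasure_factorial_moments p).2.1
  · rw [integral_erdosRenyi, min_eq_left hp]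
    simp

/-- Both laws give a multiplicity `1` with probability about `p` and larger ones with probability
`O(p ^ 2)`. -/
lemma abs_integral_edgeLaw_sub_le (M : Model) {p : ℝ≥0} (hp : p ≤ 1) {h : ℕ → ℝ} {B : ℝ}
    (hB : ∀ j, |h j| ≤ B) (hL : ∀ j : ℕ, |h j - h 0| ≤ j) :
    |∫ j, h j ∂M.edgeLaw p - ∫ j, h j ∂Model.edgeLaw .poisson p| ≤ 2 * p ^ 2 := by
  cases M
  · simp only [sub_self, abs_zero]
    positivity
  · obtain ⟨i1, e1, i2, e2⟩ := poissonMeasure_factorial_moments p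
    have hi : Integrable h (poissonMeasure p) := integrable_of_abs_le _ hB
    -- `h` is affine on `{0, 1}`, so that only multiplicities at least `2` contribute to the error
    have hlin : ∀ j : ℕ, |h j - h 0 - j * (h 1 - h 0)| ≤ 2 * ((j : ℝ) * (j - 1)) := by
      intro j
      have h1 : |h 1 - h 0| ≤ 1 := by simpa using hL 1
      rcases j with _ | _ | j
      · simp
      · simp
      · have h2 := hL (j + 2)
        push_cast at h2 ⊢
        have h3 : |((j : ℝ) + 2) * (h 1 - h 0)| ≤ j + 2 := by
          rw [abs_mul, abs_of_nonneg (by positivity)]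
          exact mul_le_of_le_one_right (by positivity) h1
        have h4 := abs_sub (h (j + 2) - h 0) (((j : ℝ) + 2) * (h 1 - h 0))
        have h5 : (0 : ℝ) ≤ j := Nat.cast_nonneg j
        rw [show (j : ℝ) + 1 + 1 = j + 2 by ring]
        nlinarith
    have hi' : Integrable (fun j => h j - h 0) (poissonMeasure p) := hi.sub (integrable_const _)
    have hmain := abs_integral_le_integral_abs (f := fun j : ℕ => h j - h 0 - j * (h 1 - h 0))
      (μ := poissonMeasure p)
    have hle : ∫ j : ℕ, |h j - h 0 - j * (h 1 - h 0)| ∂poissonMeasure p ≤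
        ∫ j : ℕ, 2 * ((j : ℝ) * (j - 1)) ∂poissonMeasure p :=
      integral_mono_of_nonneg (ae_of_all _ fun _ => abs_nonneg _) (i2.const_mul 2)
        (ae_of_all _ hlin)
    rw [integral_const_mul, e2] at hle
    rw [integral_sub hi' (i1.mul_const _),
      integral_sub hi (integrable_const _), integral_mul_const, e1] at hmain
    simp only [integral_const, probReal_univ, one_smul] at hmain
    rw [integral_erdosRenyi, min_eq_left hp, abs_sub_comm]
    refine le_trans (le_of_eq ?_) (hmain.trans hle)
    rw [Model.edgeLaw]
    congr 1
    ring

end EdgeLaw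

/-! ### Independent Poisson multiplicities as a Poisson superposition -/

section Link

variable {M : Type*} [AddCommMonoid M] [TopologicalSpace M] [DiscreteTopology M] {T : Type*}
  [Fintype T]

lemma exp_shift_eq_integral (r : ℝ≥0) (b : M) (F : BddFun M) (a : M) :
    NormedSpace.exp ((r : ℝ) • (shiftOp b - 1)) F a = ∫ j : ℕ, F (a + j • b) ∂poissonMeasure r := by
  have hG : (r : ℝ) • (shiftOp b - 1) =
      (r : ℝ) • shiftOp b + (-(r : ℝ)) • (1 : BddFun M →L[ℝ] BddFun M) := by
    rw [smul_sub, neg_smul, sub_eq_add_neg]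
  have hpow : ∀ (m : ℕ) (a : M), (((r : ℝ) • shiftOp b) ^ m) F a = r ^ m * F (a + m • b) := by
    intro m
    induction m with
    | zero => simp
    | succ m ih =>
      intro a
      rw [pow_succ', mul_apply_eq_comp, _root_.smul_apply, BddFun.smul_apply, shiftOp_apply, ih,
        succ_nsmul', add_assoc]
      ring
  rw [hG, exp_add_smul_one, _root_.smul_apply, BddFun.smul_apply, integral_poissonMeasure]
  refine (((hasSum_exp_apply ((r : ℝ) • shiftOp b) F a).mul_left _).tsum_eq).symm.trans ?_
  refine tsum_congr fun m => ?_
  rw [hpow, smul_eq_mul]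
  ring

/-- The mean over independent Poisson multiplicities is the Poisson superposition. -/
lemma integral_pi_poissonMeasure (w : T → ℝ≥0) (s : T → M) (F : BddFun M) (a : M) :
    ∫ g : T → ℕ, F (a + ∑ t, g t • s t) ∂Measure.pi (fun t => poissonMeasure (w t)) =
      poissonOp (fun t => (w t : ℝ)) s F a := by
  classical
  have key : ∀ (S : Finset T) (F : BddFun M) (a : M),
      ∫ g : T → ℕ, F (a + ∑ t ∈ S, g t • s t) ∂Measure.pi (fun t => poissonMeasure (w t)) =
        NormedSpace.exp (∑ t ∈ S, (w t : ℝ) • (shiftOp (s t) - 1)) F a := by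
    intro S
    induction S using Finset.induction_on with
    | empty => simp
    | insert t S ht ih =>
      intro F a
      have hcomm : Commute (∑ t ∈ S, (w t : ℝ) • (shiftOp (s t) - 1))
          ((w t : ℝ) • (shiftOp (s t) - 1)) :=
        Commute.sum_left _ _ _ fun t' _ => ((((commute_shiftOp _ _).sub_left
          (Commute.one_left _)).sub_right (Commute.one_right _)).smul_left _).smul_right _
      rw [Finset.sum_insert ht, add_comm, NormedSpace.exp_add_of_commute hcomm,
        mul_apply_eq_comp, ← ih]
      have hupd : (fun t => poissonMeasure (w t)) =
          Function.update (fun t => poissonMeasure (w t)) t (poissonMeasure (w t)) := by simp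
      conv_lhs => rw [hupd]
      rw [integral_pi_update _ _ _ (B := ‖F‖) fun c => F.abs_le_norm _]
      refine integral_congr_ae (ae_of_all _ fun c => ?_)
      simp only
      rw [exp_shift_eq_integral]
      refine integral_congr_ae (ae_of_all _ fun j => ?_)
      simp only
      rw [Finset.sum_insert ht, Function.update_self]
      congr 1
      rw [add_assoc, add_comm (j • s t)]
      congr 2
      refine Finset.sum_congr rfl fun t' ht' => ?_
      rw [Function.update_of_ne]
      rintro rfl
      exact ht ht'
  exact key Finset.univ F a

end Link

/-! ### Superadditivity for random tuples -/

section Tuple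

variable {𝒴 : Type*} [Fintype 𝒴] {W : ZMod 2 → 𝒴 → ℝ}

instance (α : Type*) : TopologicalSpace (Multiset α) := ⊥

instance (α : Type*) : DiscreteTopology (Multiset α) := ⟨rfl⟩

lemma obsInfo_le_card (hW : IsBISO W) {n : ℕ} (s : Multiset ((Fin n → ZMod 2) → ZMod 2)) :
    obsInfo W s ≤ n := by
  refine (obsInfo_le hW s).trans (le_of_eq ?_)
  have : Real.log 2 ≠ 0 := (Real.log_pos (by norm_num)).ne'
  simp [ZMod.card, this]

/-- The information as a bounded function of the multiset of observed bits. -/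
def obsFun (hW : IsBISO W) (n : ℕ) : BddFun (Multiset ((Fin n → ZMod 2) → ZMod 2)) :=
  BddFun.ofBound (obsInfo W) n fun s => by
    rw [Real.norm_eq_abs, abs_of_nonneg (obsInfo_nonneg hW s)]
    exact obsInfo_le_card hW s

@[simp] lemma obsFun_apply (hW : IsBISO W) (n : ℕ) (s : Multiset ((Fin n → ZMod 2) → ZMod 2)) :
    obsFun hW n s = obsInfo W s := rfl

lemma add_singleton_eq_cons {α : Type*} (s : Multiset α) (v : α) : s + {v} = v ::ₘ s := by
  rw [add_comm, Multiset.singleton_add]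

/-- The mean information of a Poisson number, of mean `α n`, of uniformly random `k`-tuples of
vertices, repetitions allowed. -/
def tupleInfo (hW : IsBISO W) (k : ℕ) (α : ℝ≥0) (n : ℕ) : ℝ :=
  poissonOp (fun _ : Fin k → Fin n => (α : ℝ) * (n / n ^ k)) (fun t => {tupleBit t}) (obsFun hW n) 0

lemma tupleInfo_weight_nonneg (α : ℝ≥0) (n k : ℕ) : (0 : ℝ) ≤ α * (n / n ^ k) := by positivity

lemma tupleInfo_nonneg (hW : IsBISO W) (k : ℕ) (α : ℝ≥0) (n : ℕ) : 0 ≤ tupleInfo hW k α n :=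
  poissonOp_nonneg (fun _ => tupleInfo_weight_nonneg α n k) _ (fun s => obsInfo_nonneg hW s) _

lemma tupleInfo_le (hW : IsBISO W) (k : ℕ) (α : ℝ≥0) (n : ℕ) : tupleInfo hW k α n ≤ n :=
  poissonOp_le (fun _ => tupleInfo_weight_nonneg α n k) _ (fun s => obsInfo_le_card hW s) _

lemma sum_tuple_weight (k n : ℕ) : ∑ _t : Fin k → Fin n, (n / n ^ k : ℝ) ≤ n := by
  rw [Finset.sum_const, Finset.card_univ, Fintype.card_fun, Fintype.card_fin, Fintype.card_fin,
    nsmul_eq_mul]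
  push_cast
  rw [mul_div_assoc']
  exact div_le_of_le_mul₀ (by positivity) (by positivity) (by rw [mul_comm])

/-- Additional tuples contribute at most the capacity each. -/
lemma tupleInfo_le_add (hW : IsBISO W) (k : ℕ) {α β : ℝ≥0} (h : α ≤ β) (n : ℕ) :
    tupleInfo hW k β n ≤ tupleInfo hW k α n + capacity W * (β - α) * n := by
  have hαβ : (α : ℝ) ≤ β := by exact_mod_cast h
  refine poissonOp_le_add (fun _ => tupleInfo_weight_nonneg α n k)
    (fun _ => tupleInfo_weight_nonneg β n k) _ _ (fun a => ?_) _
  rw [← sub_le_iff_le_add', ← Finset.sum_sub_distrib]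
  calc ∑ t : Fin k → Fin n, ((β : ℝ) * (n / n ^ k) * (obsFun hW n (a + {tupleBit t}) - obsFun hW n a)
        - α * (n / n ^ k) * (obsFun hW n (a + {tupleBit t}) - obsFun hW n a))
      ≤ ∑ t : Fin k → Fin n, (capacity W * (β - α)) * (n / n ^ k) := by
        refine Finset.sum_le_sum fun t _ => ?_
        have h1 := obsInfo_cons_le hW (tupleBit t) a
        simp only [obsFun_apply, add_singleton_eq_cons]
        have h2 : (0 : ℝ) ≤ (β - α) * (n / n ^ k) := mul_nonneg (by linarith) (by positivity)
        have := mul_le_mul_of_nonneg_left h1 h2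
        linarith
    _ ≤ capacity W * (β - α) * n := by
        rw [← Finset.mul_sum]
        exact mul_le_mul_of_nonneg_left (sum_tuple_weight k n)
          (mul_nonneg (capacity_nonneg hW) (by linarith))

lemma tupleInfo_zero (hW : IsBISO W) (k n : ℕ) : tupleInfo hW k 0 n = 0 := by
  rw [tupleInfo, poissonOp, exp_apply_eq_self]
  · exact obsInfo_zero
  · ext a
    simp [poissonGen_apply]

lemma tupleInfo_le_capacity (hW : IsBISO W) (k : ℕ) (α : ℝ≥0) (n : ℕ) :
    tupleInfo hW k α n ≤ capacity W * α * n := by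
  have := tupleInfo_le_add hW k (zero_le (a := α)) n
  rw [tupleInfo_zero] at this
  simpa using this

/-- Two disjoint blocks carry at most as much information as their union. -/
lemma tupleInfo_superadditive (hW : IsBISO W) {k : ℕ} (hk : Even k) (α : ℝ≥0) {n₁ n₂ : ℕ}
    (h₁ : 0 < n₁) (h₂ : 0 < n₂) :
    tupleInfo hW k α n₁ + tupleInfo hW k α n₂ ≤ tupleInfo hW k α (n₁ + n₂) := by
  set p : (Fin (n₁ + n₂) → ZMod 2) ≃ (Fin n₁ → ZMod 2) × (Fin n₂ → ZMod 2) :=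
    (Fin.appendEquiv n₁ n₂).symm with hp
  set j₁ : ((Fin n₁ → ZMod 2) → ZMod 2) → (Fin (n₁ + n₂) → ZMod 2) → ZMod 2 :=
    fun u x => u (p x).1 with hj₁
  set j₂ : ((Fin n₂ → ZMod 2) → ZMod 2) → (Fin (n₁ + n₂) → ZMod 2) → ZMod 2 :=
    fun u x => u (p x).2 with hj₂
  set w₁ : (Fin k → Fin n₁) → ℝ := fun _ => α * (n₁ / n₁ ^ k)
  set w₂ : (Fin k → Fin n₂) → ℝ := fun _ => α * (n₂ / n₂ ^ k)
  set s₁ : (Fin k → Fin n₁) → Multiset ((Fin (n₁ + n₂) → ZMod 2) → ZMod 2) :=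
    fun t => {j₁ (tupleBit t)} with hs₁
  set s₂ : (Fin k → Fin n₂) → Multiset ((Fin (n₁ + n₂) → ZMod 2) → ZMod 2) :=
    fun t => {j₂ (tupleBit t)} with hs₂
  set F := obsFun hW (n₁ + n₂) with hF
  -- given the observations in the left block, integrate over those in the right block
  have hright : ∀ s : Multiset ((Fin n₁ → ZMod 2) → ZMod 2),
      (obsFun hW n₁ + BddFun.const (Multiset ((Fin n₁ → ZMod 2) → ZMod 2)) (tupleInfo hW k α n₂)) s =
        poissonOp w₂ s₂ F (s.map j₁) := by
    intro s
    have h := poissonOp_map w₂ (s := fun t => {tupleBit t}) (s' := s₂)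
      (φ := fun t : Multiset ((Fin n₂ → ZMod 2) → ZMod 2) => s.map j₁ + t.map j₂) (f := F)
      (g := obsFun hW n₂ + BddFun.const (Multiset ((Fin n₂ → ZMod 2) → ZMod 2)) (obsInfo W s))
      (fun a t => by simp [hs₂, Multiset.map_add, add_assoc])
      (fun a => by
        rw [hF, BddFun.add_apply, BddFun.const_apply, obsFun_apply, obsFun_apply, add_comm]
        exact (obsInfo_prod hW p s a).symm) 0
    simp only [Multiset.map_zero, add_zero] at h
    rw [h, map_add, poissonOp_const, BddFun.add_apply, BddFun.add_apply, BddFun.const_apply,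
      BddFun.const_apply, obsFun_apply, tupleInfo]
    exact add_comm _ _
  have hleft : poissonOp w₁ s₁ (poissonOp w₂ s₂ F) 0 =
      tupleInfo hW k α n₁ + tupleInfo hW k α n₂ := by
    have h := poissonOp_map w₁ (s := fun t => {tupleBit t}) (s' := s₁)
      (φ := fun t : Multiset ((Fin n₁ → ZMod 2) → ZMod 2) => t.map j₁)
      (f := poissonOp w₂ s₂ F)
      (g := obsFun hW n₁ + BddFun.const (Multiset ((Fin n₁ → ZMod 2) → ZMod 2)) (tupleInfo hW k α n₂))
      (fun a t => by simp [hs₁, Multiset.map_add]) hright 0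
    simp only [Multiset.map_zero] at h
    rw [h, map_add, poissonOp_const, BddFun.add_apply, BddFun.const_apply]
    rfl
  rw [← hleft, ← poissonOp_sum]
  refine (poissonOp_le_add (ε := 0) (fun _ => tupleInfo_weight_nonneg α (n₁ + n₂) k)
    (fun t => ?_) (fun t => {tupleBit t}) _ (fun a => ?_) 0).trans (le_of_eq (add_zero _))
  · rcases t with t | t
    · exact tupleInfo_weight_nonneg α n₁ k
    · exact tupleInfo_weight_nonneg α n₂ k
  · have h := mul_le_mul_of_nonneg_left (sum_obsInfo_split_le hW hk h₁ h₂ a) α.coe_nonneg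
    rw [mul_add, Finset.mul_sum, Finset.mul_sum, Finset.mul_sum] at h
    rw [Fintype.sum_sum_type, add_zero]
    simp only [← mul_assoc] at h
    simp only [Sum.elim_inl, Sum.elim_inr, hs₁, hs₂, add_singleton_eq_cons, hF, obsFun_apply]
    exact h

/-- The limit of the mean information per vertex. -/
lemma exists_tendsto_tupleInfo_div (hW : IsBISO W) {k : ℕ} (hk : Even k) (α : ℝ≥0) :
    ∃ c : ℝ, Tendsto (fun n : ℕ => tupleInfo hW k α n / n) atTop (𝓝 c) := by
  have hzero : tupleInfo hW k α 0 = 0 :=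
    le_antisymm (by simpa using tupleInfo_le hW k α 0) (tupleInfo_nonneg hW k α 0)
  have hsub : Subadditive fun n => -tupleInfo hW k α n := by
    intro m n
    rcases m.eq_zero_or_pos with rfl | hm
    · simp [hzero]
    rcases n.eq_zero_or_pos with rfl | hn
    · simp [hzero]
    linarith [tupleInfo_superadditive hW hk α hm hn]
  have hbdd : BddBelow (Set.range fun n : ℕ => -tupleInfo hW k α n / n) := by
    refine ⟨-1, ?_⟩
    rintro _ ⟨n, rfl⟩
    simp only
    rw [neg_div, neg_le_neg_iff]
    exact div_le_one_of_le₀ (tupleInfo_le hW k α n) (Nat.cast_nonneg n)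
  refine ⟨-hsub.lim, ?_⟩
  have := (hsub.tendsto_lim hbdd).neg
  simpa only [neg_div, neg_neg] using this

end Tuple

/-! ### Random hyperedges versus random tuples -/

section Subsets

variable {𝒴 : Type*} [Fintype 𝒴] {W : ZMod 2 → 𝒴 → ℝ} {k n : ℕ}

/-- The code bit of the hyperedge `I`: the parity of the information bits at its vertices. -/
def edgeBit (I : Finset (Fin n)) (x : Fin n → ZMod 2) : ZMod 2 := ∑ i ∈ I, x i

lemma codeInfo_eq_obsInfo (hW : IsBISO W) (g : MultiHypergraph k n) :
    codeInfo W g = obsInfo W (∑ I, g I • {edgeBit I.1}) := by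
  rw [codeInfo_eq_familyInfo hW, familyInfo_eq_obsInfo]
  congr 1
  have h : (fun (e : Edge g) x => Matrix.vecMul x (generatorMatrix g) e) =
      fun e => edgeBit e.1.1 := by
    funext e x
    simp [Matrix.vecMul, dotProduct, generatorMatrix, edgeBit]
  rw [h, ← Multiset.sum_map_singleton (Finset.univ.val.map _), Multiset.map_map]
  refine (Fintype.sum_sigma (fun e : Edge g => ({edgeBit e.1.1} :
    Multiset ((Fin n → ZMod 2) → ZMod 2)))).trans ?_
  simp

lemma abs_codeInfo_le (hW : IsBISO W) (g : MultiHypergraph k n) : |codeInfo W g| ≤ n := by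
  rw [codeInfo_eq_obsInfo hW, abs_of_nonneg (obsInfo_nonneg hW _)]
  exact obsInfo_le_card hW _

lemma obsInfo_add_nsmul (hW : IsBISO W) (v : (Fin n → ZMod 2) → ZMod 2)
    (s : Multiset ((Fin n → ZMod 2) → ZMod 2)) (j : ℕ) :
    |obsInfo W (s + j • {v}) - obsInfo W s| ≤ j := by
  induction j with
  | zero => simp
  | succ j ih =>
    rw [succ_nsmul, ← add_assoc, add_singleton_eq_cons]
    have h1 := obsInfo_cons_nonneg hW v (s + j • {v})
    have h2 := (obsInfo_cons_le hW v (s + j • {v})).trans (capacity_le_one hW)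
    rw [abs_le] at ih ⊢
    push_cast
    constructor <;> linarith

/-- One more observation of a bit adds between `0` and `1` bits of information. -/
lemma isEdgeLipschitz_codeInfo (hW : IsBISO W) :
    IsEdgeLipschitz (codeInfo W : MultiHypergraph k n → ℝ) := by
  intro g I j
  have h : ∀ i : ℕ, ∑ J, Function.update g I i J • ({edgeBit J.1} :
      Multiset ((Fin n → ZMod 2) → ZMod 2)) =
      ∑ J ∈ Finset.univ.erase I, g J • {edgeBit J.1} + i • {edgeBit I.1} := by
    intro i
    rw [← Finset.sum_erase_add _ _ (Finset.mem_univ I), Function.update_self]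
    congr 1
    exact Finset.sum_congr rfl fun J hJ => by
      rw [Function.update_of_ne (Finset.ne_of_mem_erase hJ)]
  rw [codeInfo_eq_obsInfo hW, codeInfo_eq_obsInfo hW, h, h, zero_nsmul, add_zero]
  exact obsInfo_add_nsmul hW _ _ _

lemma integral_codeInfo_poisson (hW : IsBISO W) (α : ℝ≥0) :
    ∫ g, codeInfo W g ∂ensemble .poisson k α n =
      poissonOp (fun _ : HyperEdge k n => ((α * n / n.choose k : ℝ≥0) : ℝ))
        (fun I => {edgeBit I.1}) (obsFun hW n) 0 := by
  rw [← integral_pi_poissonMeasure (fun _ : HyperEdge k n => α * n / n.choose k)]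
  simp only [zero_add, obsFun_apply, ← codeInfo_eq_obsInfo hW]
  rfl

/-- Every `k`-subset is the image of `k!` injective tuples. -/
lemma card_injective_image_eq (I : HyperEdge k n) :
    ((Finset.univ.filter fun t : Fin k → Fin n => Function.Injective t).filter
      fun t => Finset.univ.image t = I.1).card = k.factorial := by
  have e : {t : Fin k → Fin n // Function.Injective t ∧ Finset.univ.image t = I.1} ≃
      (Fin k ≃ I.1) :=
    { toFun := fun t => Equiv.ofBijective
        (fun l => ⟨t.1 l, t.2.2.subset (Finset.mem_image_of_mem _ (Finset.mem_univ l))⟩)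
        ⟨fun a b h => t.2.1 (congrArg Subtype.val h), fun i => by
          obtain ⟨l, -, hl⟩ := Finset.mem_image.1 (t.2.2.symm.subset i.2)
          exact ⟨l, Subtype.ext hl⟩⟩
      invFun := fun e => ⟨fun l => (e l).1, fun a b h => e.injective (Subtype.ext h), by
        ext i
        simp only [Finset.mem_image, Finset.mem_univ, true_and]
        constructor
        · rintro ⟨l, rfl⟩
          exact (e l).2
        · exact fun hi => ⟨e.symm ⟨i, hi⟩, by simp⟩⟩
      left_inv := fun t => rfl
      right_inv := fun e => by ext l; rfl }
  rw [Finset.filter_filter, ← Fintype.card_subtype, Fintype.card_congr e,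
    Fintype.card_equiv (I.1.equivFinOfCardEq I.2).symm, Fintype.card_fin]

lemma sum_injective_tuple (f : Finset (Fin n) → ℝ) :
    ∑ t : Fin k → Fin n with Function.Injective t, f (Finset.univ.image t) =
      k.factorial * ∑ I : HyperEdge k n, f I.1 := by
  have hmaps : ∀ t ∈ Finset.univ.filter fun t : Fin k → Fin n => Function.Injective t,
      Finset.univ.image t ∈ Finset.univ.filter fun J : Finset (Fin n) => J.card = k := by
    intro t ht
    simp only [Finset.mem_filter, Finset.mem_univ, true_and] at ht ⊢
    rw [Finset.card_image_of_injective _ ht, Finset.card_univ, Fintype.card_fin]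
  rw [← Finset.sum_fiberwise_of_maps_to hmaps, Finset.mul_sum]
  rw [Finset.sum_subtype (Finset.univ.filter fun J : Finset (Fin n) => J.card = k)
    (p := fun J => J.card = k) (by simp)]
  refine Finset.sum_congr rfl fun I _ => ?_
  rw [Finset.sum_congr rfl fun t ht => by rw [(Finset.mem_filter.1 ht).2], Finset.sum_const,
    card_injective_image_eq, nsmul_eq_mul]

lemma tupleBit_eq_edgeBit {t : Fin k → Fin n} (ht : Function.Injective t) :
    tupleBit t = edgeBit (Finset.univ.image t) := by
  funext x
  rw [tupleBit, edgeBit, Finset.sum_image fun a _ b _ h => ht h]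

lemma card_hyperEdge (k n : ℕ) : Fintype.card (HyperEdge k n) = n.choose k := by
  rw [Fintype.card_finset_len, Fintype.card_fin]

/-- Most tuples have no repetition. -/
lemma one_sub_le_choose_mul_factorial (hk : 0 < k) (hkn : k ≤ n) :
    (n : ℝ) ^ k * (1 - k ^ 2 / n) ≤ n.choose k * k.factorial := by
  have hn : (0 : ℝ) < n := by exact_mod_cast lt_of_lt_of_le hk hkn
  have h1 : ((n + 1 - k : ℕ) : ℝ) ^ k ≤ n.choose k * k.factorial := by
    have := Nat.pow_sub_le_descFactorial n k
    rw [Nat.descFactorial_eq_factorial_mul_choose, mul_comm] at this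
    exact_mod_cast this
  refine le_trans ?_ h1
  have hkn' : (k : ℝ) ≤ n := by exact_mod_cast hkn
  have h2 : (1 + (k : ℝ) * (-(k / n))) ≤ (1 + -((k : ℝ) / n)) ^ k :=
    one_add_mul_le_pow (by
      have : (k : ℝ) / n ≤ 1 := div_le_one_of_le₀ hkn' hn.le
      linarith) k
  have h3 : (n : ℝ) * (1 + -((k : ℝ) / n)) ≤ (n + 1 - k : ℕ) := by
    rw [Nat.cast_sub (by omega)]
    push_cast
    rw [mul_add, mul_neg, mul_div_cancel₀ _ hn.ne']
    linarith
  have h4 : 0 ≤ (n : ℝ) * (1 + -((k : ℝ) / n)) := by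
    rw [mul_add, mul_neg, mul_div_cancel₀ _ hn.ne']
    linarith
  calc (n : ℝ) ^ k * (1 - k ^ 2 / n) = n ^ k * (1 + (k : ℝ) * (-(k / n))) := by ring
    _ ≤ n ^ k * (1 + -((k : ℝ) / n)) ^ k := mul_le_mul_of_nonneg_left h2 (by positivity)
    _ = (n * (1 + -((k : ℝ) / n))) ^ k := (mul_pow _ _ _).symm
    _ ≤ _ := pow_le_pow_left₀ h4 h3 k

/-- Random hyperedges and random tuples differ only through tuples with repetitions, of which there
is a bounded number on average. -/
lemma abs_integral_codeInfo_poisson_sub_le (hW : IsBISO W) (hk : 0 < k) (hkn : k ≤ n) (α : ℝ≥0) :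
    |∫ g, codeInfo W g ∂ensemble .poisson k α n - tupleInfo hW k α n| ≤ α * k ^ 2 := by
  have hn : (0 : ℝ) < n := by exact_mod_cast lt_of_lt_of_le hk hkn
  have hN : (0 : ℝ) < n.choose k := by exact_mod_cast Nat.choose_pos hkn
  set N : ℝ := (n.choose k : ℝ) with hNdef
  set q : ℝ := (n : ℝ) ^ k with hq
  have hqpos : 0 < q := by positivity
  have hfac := one_sub_le_choose_mul_factorial hk hkn
  rw [← hNdef, ← hq] at hfac
  have hle : N * k.factorial ≤ q := by
    have := Nat.descFactorial_le_pow n k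
    rw [Nat.descFactorial_eq_factorial_mul_choose, mul_comm] at this
    rw [hNdef, hq]
    exact_mod_cast this
  rw [integral_codeInfo_poisson hW, tupleInfo]
  -- compare the two generators at an arbitrary configuration: `D` is the total increment over the
  -- hyperedges and `R` the one over the tuples with repetitions
  have hgen : ∀ a : Multiset ((Fin n → ZMod 2) → ZMod 2), ∃ D R : ℝ, 0 ≤ D ∧ D ≤ N ∧ 0 ≤ R ∧
      R ≤ q - N * k.factorial ∧
      ∑ I : HyperEdge k n, ((α * n / n.choose k : ℝ≥0) : ℝ) *
        (obsFun hW n (a + {edgeBit I.1}) - obsFun hW n a) = α * n / N * D ∧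
      ∑ t : Fin k → Fin n, (α : ℝ) * (n / n ^ k) *
        (obsFun hW n (a + {tupleBit t}) - obsFun hW n a) =
          α * (n / q) * (k.factorial * D + R) := by
    intro a
    have h0 : ∀ v, 0 ≤ obsFun hW n (a + {v}) - obsFun hW n a := fun v => by
      rw [add_singleton_eq_cons]
      exact obsInfo_cons_nonneg hW v a
    have h1 : ∀ v, obsFun hW n (a + {v}) - obsFun hW n a ≤ 1 := fun v => by
      rw [add_singleton_eq_cons]
      exact (obsInfo_cons_le hW v a).trans (capacity_le_one hW)
    refine ⟨∑ I : HyperEdge k n, (obsFun hW n (a + {edgeBit I.1}) - obsFun hW n a),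
      ∑ t : Fin k → Fin n with ¬ Function.Injective t,
        (obsFun hW n (a + {tupleBit t}) - obsFun hW n a),
      Finset.sum_nonneg fun _ _ => h0 _, ?_, Finset.sum_nonneg fun _ _ => h0 _, ?_, ?_, ?_⟩
    · refine (Finset.sum_le_sum fun I _ => h1 _).trans (le_of_eq ?_)
      rw [Finset.sum_const, Finset.card_univ, card_hyperEdge, nsmul_eq_mul, mul_one]
    · refine (Finset.sum_le_sum fun I _ => h1 _).trans (le_of_eq ?_)
      have hinj := sum_injective_tuple (k := k) (n := n) fun _ => 1
      have hall := Finset.sum_filter_add_sum_filter_not (Finset.univ : Finset (Fin k → Fin n))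
        (fun t => Function.Injective t) (fun _ => (1 : ℝ))
      have hcard : ∑ _I : HyperEdge k n, (1 : ℝ) = N := by
        rw [Finset.sum_const, Finset.card_univ, card_hyperEdge, nsmul_eq_mul, mul_one]
      rw [hinj, hcard] at hall
      have htot : ∑ _t : Fin k → Fin n, (1 : ℝ) = q := by
        simp [hq]
      rw [htot] at hall
      linarith
    · rw [Finset.mul_sum]
      refine Finset.sum_congr rfl fun I _ => ?_
      push_cast
      rfl
    · rw [← Finset.mul_sum, ← Finset.sum_filter_add_sum_filter_not
        (Finset.univ : Finset (Fin k → Fin n)) (fun t => Function.Injective t)]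
      congr 2
      rw [← sum_injective_tuple fun J => obsFun hW n (a + {edgeBit J}) - obsFun hW n a]
      refine Finset.sum_congr rfl fun t ht => ?_
      rw [tupleBit_eq_edgeBit (Finset.mem_filter.1 ht).2]
  -- the fraction of tuples with repetitions is at most `k ^ 2 / n`
  have hδ : (α : ℝ) * (n / q) * (q - N * k.factorial) ≤ α * k ^ 2 := by
    rw [mul_assoc]
    refine mul_le_mul_of_nonneg_left ?_ α.coe_nonneg
    rw [div_mul_eq_mul_div, div_le_iff₀ hqpos]
    have h5 : q * (1 - k ^ 2 / n) * n = q * n - q * k ^ 2 := by field_simp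
    nlinarith [mul_le_mul_of_nonneg_right hfac hn.le]
  have hsub : ∀ D : ℝ, α * n / N * D - α * (n / q) * (k.factorial * D) =
      α * (n / q) * (q - N * k.factorial) * (D / N) := fun D => by field_simp
  have hpos : 0 ≤ α * (n / q) * (q - N * k.factorial) := mul_nonneg (by positivity) (by linarith)
  have hw : ∀ _I : HyperEdge k n, (0 : ℝ) ≤ ((α * n / n.choose k : ℝ≥0) : ℝ) :=
    fun _ => NNReal.coe_nonneg _
  have hw' : ∀ _t : Fin k → Fin n, (0 : ℝ) ≤ α * (n / n ^ k) :=
    fun _ => tupleInfo_weight_nonneg α n k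
  rw [abs_le]
  constructor
  · have := poissonOp_le_add (ε := α * k ^ 2) hw hw' (fun I => {edgeBit I.1})
      (fun t => {tupleBit t}) (f := obsFun hW n) (fun a => by
        obtain ⟨D, R, hD, hDN, hR, hRq, e1, e2⟩ := hgen a
        rw [e1, e2]
        have h8 := hsub D
        have h7 := mul_nonneg hpos (div_nonneg hD hN.le)
        have h9 := mul_le_mul_of_nonneg_left hRq (show (0 : ℝ) ≤ α * (n / q) by positivity)
        linarith) 0
    linarith
  · have := poissonOp_le_add (ε := α * k ^ 2) hw' hw (fun t => {tupleBit t})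
      (fun I => {edgeBit I.1}) (f := obsFun hW n) (fun a => by
        obtain ⟨D, R, hD, hDN, hR, hRq, e1, e2⟩ := hgen a
        rw [e1, e2]
        have h9 : 0 ≤ α * (n / q) * R := by positivity
        have h8 := hsub D
        have h7 := mul_le_of_le_one_right hpos (div_le_one_of_le₀ hDN hN.le)
        linarith) 0
    linarith

end Subsets

/-! ### Concentration -/

section Concentration

/-- Chebyshev's inequality for a sequence of random variables with variance `O(n)`. -/
lemma tendsto_measure_of_variance_le {Ω : ℕ → Type*} [∀ n, MeasurableSpace (Ω n)]
    (μ : ∀ n, Measure (Ω n)) [∀ n, IsProbabilityMeasure (μ n)] (X : ∀ n, Ω n → ℝ) {c K : ℝ}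
    (hX : ∀ n, MemLp (X n) 2 (μ n))
    (hmean : Tendsto (fun n : ℕ => (∫ ω, X n ω ∂μ n) / n) atTop (𝓝 c))
    (hvar : ∀ᶠ n : ℕ in atTop, variance (X n) (μ n) ≤ K * n) {ε : ℝ} (hε : 0 < ε) :
    Tendsto (fun n => μ n {ω | ε ≤ |X n ω / n - c|}) atTop (𝓝 0) := by
  have hlim : Tendsto (fun n : ℕ => ENNReal.ofReal (K / (ε / 2) ^ 2 / n)) atTop (𝓝 0) := by
    rw [← ENNReal.ofReal_zero]
    exact ENNReal.tendsto_ofReal (tendsto_const_div_atTop_nhds_zero_nat _)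
  refine tendsto_of_tendsto_of_tendsto_of_le_of_le' tendsto_const_nhds hlim
    (Eventually.of_forall fun _ => zero_le) ?_
  filter_upwards [hvar, eventually_gt_atTop 0,
    (Metric.tendsto_nhds.1 hmean) (ε / 2) (by positivity)] with n hv hn hm
  have hn' : (0 : ℝ) < n := by exact_mod_cast hn
  have hsub : {ω | ε ≤ |X n ω / n - c|} ⊆
      {ω | ε / 2 * n ≤ |X n ω - ∫ ω, X n ω ∂μ n|} := by
    intro ω hω
    rw [Set.mem_ofPred_eq] at hω ⊢
    rw [Real.dist_eq] at hm
    have h1 := abs_sub_le (X n ω / n) ((∫ ω, X n ω ∂μ n) / n) c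
    have h2 : |X n ω / n - (∫ ω, X n ω ∂μ n) / n| = |X n ω - ∫ ω, X n ω ∂μ n| / n := by
      rw [← sub_div, abs_div, abs_of_pos hn']
    rw [← le_div_iff₀ hn', ← h2]
    linarith
  refine (measure_mono hsub).trans ((meas_ge_le_variance_div_sq (hX n) (by positivity)).trans ?_)
  refine ENNReal.ofReal_le_ofReal ?_
  rw [mul_pow, div_div, div_le_div_iff₀ (by positivity) (by positivity)]
  have h3 := mul_le_mul_of_nonneg_right hv (show (0 : ℝ) ≤ (ε / 2) ^ 2 * n by positivity)
  linarith

variable {𝒴 : Type*} [Fintype 𝒴] {W : ZMod 2 → 𝒴 → ℝ} {k n : ℕ}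

/-- The parameter `α n / (n choose k)` of the edge law. -/
abbrev edgeParam (k : ℕ) (α : ℝ≥0) (n : ℕ) : ℝ≥0 := α * n / n.choose k

instance (M : Model) (k : ℕ) (α : ℝ≥0) (n : ℕ) : IsProbabilityMeasure (ensemble M k α n) :=
  inferInstanceAs (IsProbabilityMeasure (Measure.pi fun _ => M.edgeLaw (edgeParam k α n)))

lemma choose_mul_edgeParam (hkn : k ≤ n) (α : ℝ≥0) :
    (n.choose k : ℝ) * edgeParam k α n = α * n := by
  have : (n.choose k : ℝ) ≠ 0 := by exact_mod_cast (Nat.choose_pos hkn).ne'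
  push_cast
  field_simp

/-- For `k ≥ 2` the random hypergraphs are sparse. -/
lemma tendsto_edgeParam (hk : 2 ≤ k) (α : ℝ≥0) :
    Tendsto (fun n => (edgeParam k α n : ℝ)) atTop (𝓝 0) := by
  refine squeeze_zero' (Eventually.of_forall fun n => NNReal.coe_nonneg _) ?_
    (tendsto_const_div_atTop_nhds_zero_nat (4 * (α : ℝ) * (k.factorial : ℝ)))
  filter_upwards [eventually_ge_atTop (2 * k)] with n hn
  have hn' : (2 * k : ℝ) ≤ n := by exact_mod_cast hn
  have hk' : (2 : ℝ) ≤ k := by exact_mod_cast hk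
  have hnpos : (0 : ℝ) < n := by linarith
  have hN : (0 : ℝ) < n.choose k := by exact_mod_cast Nat.choose_pos (by omega : k ≤ n)
  have hf : (0 : ℝ) < k.factorial := by exact_mod_cast k.factorial_pos
  have h1 : ((n : ℝ) / 2) ^ 2 / k.factorial ≤ n.choose k := by
    refine le_trans ?_ (Nat.pow_le_choose k n)
    refine div_le_div_of_nonneg_right ?_ hf.le
    have h2 : (n : ℝ) / 2 ≤ (n + 1 - k : ℕ) := by
      rw [Nat.cast_sub (by omega)]
      push_cast
      linarith
    calc ((n : ℝ) / 2) ^ 2 ≤ (n / 2) ^ k := pow_le_pow_right₀ (by linarith) hk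
      _ ≤ _ := pow_le_pow_left₀ (by positivity) h2 k
  push_cast
  rw [div_le_div_iff₀ hN hnpos]
  rw [div_le_iff₀ hf] at h1
  have h4 := mul_le_mul_of_nonneg_left h1 α.coe_nonneg
  nlinarith

lemma eventually_edgeParam_le_one (hk : 2 ≤ k) (α : ℝ≥0) :
    ∀ᶠ n in atTop, edgeParam k α n ≤ 1 := by
  filter_upwards [(tendsto_edgeParam hk α).eventually_le_const zero_lt_one] with n hn
  exact_mod_cast hn

lemma sum_second_moment_le (hkn : k ≤ n) {α : ℝ≥0} (hp : edgeParam k α n ≤ 1) (M : Model) :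
    ∑ _I : HyperEdge k n, ∫ j : ℕ, (j : ℝ) ^ 2 ∂M.edgeLaw (edgeParam k α n) ≤ 2 * α * n := by
  have hp' : (edgeParam k α n : ℝ) ≤ 1 := by exact_mod_cast hp
  rw [Finset.sum_const, Finset.card_univ, card_hyperEdge, nsmul_eq_mul]
  have h1 := integral_sq_edgeLaw_le M (edgeParam k α n)
  have h2 := choose_mul_edgeParam hkn α
  have h3 : (edgeParam k α n : ℝ) ^ 2 ≤ edgeParam k α n := by
    rw [sq]
    exact mul_le_of_le_one_right (NNReal.coe_nonneg _) hp'
  calc (n.choose k : ℝ) * ∫ j : ℕ, (j : ℝ) ^ 2 ∂M.edgeLaw (edgeParam k α n)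
      ≤ n.choose k * (2 * edgeParam k α n) :=
        mul_le_mul_of_nonneg_left (by linarith) (Nat.cast_nonneg _)
    _ = 2 * α * n := by rw [mul_left_comm, h2]; ring

lemma memLp_codeInfo (hW : IsBISO W) (M : Model) (α : ℝ≥0) :
    MemLp (codeInfo W) 2 (ensemble M k α n) :=
  MemLp.of_bound Measurable.of_discrete.aestronglyMeasurable n
    (ae_of_all _ fun g => (Real.norm_eq_abs _).trans_le (abs_codeInfo_le hW g))

lemma variance_codeInfo_le (hW : IsBISO W) (hkn : k ≤ n) {α : ℝ≥0} (hp : edgeParam k α n ≤ 1)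
    (M : Model) : variance (codeInfo W) (ensemble M k α n) ≤ 2 * α * n := by
  rw [variance_eq_sub (memLp_codeInfo hW M α)]
  exact (integral_sq_sub_le (fun _ : HyperEdge k n => M.edgeLaw (edgeParam k α n))
    (fun _ => integrable_sq_edgeLaw M _) (abs_codeInfo_le hW)
    (isEdgeLipschitz_codeInfo hW)).trans (sum_second_moment_le hkn hp M)

/-- The mean information per vertex has the same limit in both ensembles as for random tuples. -/
lemma tendsto_integral_codeInfo_div (hW : IsBISO W) (hk : 2 ≤ k) {α : ℝ≥0} {c : ℝ}
    (hc : Tendsto (fun n : ℕ => tupleInfo hW k α n / n) atTop (𝓝 c)) (M : Model) :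
    Tendsto (fun n : ℕ => (∫ g, codeInfo W g ∂ensemble M k α n) / n) atTop (𝓝 c) := by
  refine tendsto_of_tendsto_of_dist hc ?_
  have hlim : Tendsto (fun n : ℕ => α * k ^ 2 / (n : ℝ) + 2 * α * edgeParam k α n) atTop (𝓝 0) := by
    simpa using (tendsto_const_div_atTop_nhds_zero_nat ((α : ℝ) * k ^ 2)).add
      ((tendsto_edgeParam hk α).const_mul (2 * (α : ℝ)))
  refine squeeze_zero' (Eventually.of_forall fun _ => dist_nonneg) ?_ hlim
  filter_upwards [eventually_ge_atTop k, eventually_edgeParam_le_one hk α] with n hkn hp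
  have hn : (0 : ℝ) < n := by exact_mod_cast (by omega : 0 < n)
  have h1 := abs_integral_codeInfo_poisson_sub_le hW (by omega : 0 < k) hkn α
  have h2 := abs_integral_pi_sub_le (fun _ : HyperEdge k n => Model.poisson.edgeLaw
    (edgeParam k α n)) (fun _ => M.edgeLaw (edgeParam k α n))
    (fun _ h hB hL => abs_integral_edgeLaw_sub_le M hp hB hL) (abs_codeInfo_le hW)
    (isEdgeLipschitz_codeInfo hW)
  rw [card_hyperEdge] at h2
  have h3 : (n.choose k : ℝ) * (2 * (edgeParam k α n : ℝ) ^ 2) = 2 * α * edgeParam k α n * n := by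
    have := choose_mul_edgeParam hkn α
    linear_combination 2 * (edgeParam k α n : ℝ) * this
  rw [h3] at h2
  rw [Real.dist_eq, ← sub_div, abs_div, abs_of_pos hn, div_le_iff₀ hn, add_mul,
    div_mul_cancel₀ _ hn.ne', abs_sub_comm]
  have h4 := abs_sub_le (∫ g, codeInfo W g ∂ensemble M k α n)
    (∫ g, codeInfo W g ∂ensemble .poisson k α n) (tupleInfo hW k α n)
  simp only [ensemble] at h1 h4 ⊢
  linarith

theorem tendsto_codeInfo_div (hW : IsBISO W) (hk : 2 ≤ k) {α : ℝ≥0} {c : ℝ}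
    (hc : Tendsto (fun n : ℕ => tupleInfo hW k α n / n) atTop (𝓝 c)) (M : Model) {ε : ℝ}
    (hε : 0 < ε) :
    Tendsto (fun n : ℕ => ensemble M k α n {g | ε ≤ |codeInfo W g / n - c|}) atTop (𝓝 0) := by
  refine tendsto_measure_of_variance_le (K := 2 * α) (fun n => ensemble M k α n)
    (fun n g => codeInfo W g) (fun n => memLp_codeInfo hW M α)
    (tendsto_integral_codeInfo_div hW hk hc M) ?_ hε
  filter_upwards [eventually_ge_atTop k, eventually_edgeParam_le_one hk α] with n hkn hp
  exact variance_codeInfo_le hW hkn hp M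

lemma numEdges_eq_sum (g : MultiHypergraph k n) : (numEdges g : ℝ) = ∑ I, (g I : ℝ) := by
  rw [numEdges, Fintype.card_sigma]
  simp

lemma memLp_edgeLaw (M : Model) (p : ℝ≥0) : MemLp (fun j : ℕ => (j : ℝ)) 2 (M.edgeLaw p) :=
  (memLp_two_iff_integrable_sq Measurable.of_discrete.aestronglyMeasurable).2
    (integrable_sq_edgeLaw M p)

lemma memLp_eval (M : Model) (α : ℝ≥0) (I : HyperEdge k n) :
    MemLp (fun g : MultiHypergraph k n => (g I : ℝ)) 2 (ensemble M k α n) :=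
  (memLp_edgeLaw M (edgeParam k α n)).comp_measurePreserving (measurePreserving_eval _ I)

/-- The number of edges concentrates around `α n`. -/
theorem tendsto_numEdges_div (hk : 2 ≤ k) (α : ℝ≥0) (M : Model) {ε : ℝ} (hε : 0 < ε) :
    Tendsto (fun n : ℕ => ensemble M k α n {g | ε ≤ |(numEdges g : ℝ) / n - α|}) atTop (𝓝 0) := by
  refine tendsto_measure_of_variance_le (K := 2 * α) (fun n => ensemble M k α n)
    (fun n g => (numEdges g : ℝ)) (fun n => ?_) ?_ ?_ hε
  · simp only [numEdges_eq_sum]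
    exact memLp_finsetSum _ fun I _ => memLp_eval M α I
  · refine tendsto_const_nhds.congr' ?_
    filter_upwards [eventually_ge_atTop k, eventually_edgeParam_le_one hk α] with n hkn hp
    have hn : (0 : ℝ) < n := by exact_mod_cast (by omega : 0 < n)
    have hI : ∀ I : HyperEdge k n, ∫ g, (g I : ℝ) ∂ensemble M k α n = edgeParam k α n := by
      intro I
      rw [← integral_edgeLaw M hp]
      have hI := measurePreserving_eval (fun _ : HyperEdge k n => M.edgeLaw (edgeParam k α n)) I
      have h := integral_map
        (μ := Measure.pi fun _ : HyperEdge k n => M.edgeLaw (edgeParam k α n))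
        (f := fun j : ℕ => (j : ℝ)) hI.measurable.aemeasurable
        Measurable.of_discrete.aestronglyMeasurable
      rw [hI.map_eq] at h
      exact h.symm
    simp only [numEdges_eq_sum]
    rw [integral_finsetSum _ fun I _ => (memLp_eval M α I).integrable one_le_two]
    simp only [hI, Finset.sum_const, Finset.card_univ, card_hyperEdge, nsmul_eq_mul]
    rw [choose_mul_edgeParam hkn, mul_div_cancel_right₀ _ hn.ne']
  · filter_upwards [eventually_ge_atTop k, eventually_edgeParam_le_one hk α] with n hkn hp
    have hsum : (fun g : MultiHypergraph k n => (numEdges g : ℝ)) =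
        ∑ I, fun g : MultiHypergraph k n => (g I : ℝ) := by
      funext g
      rw [numEdges_eq_sum, Finset.sum_apply]
    rw [hsum]
    refine (variance_sum_pi (μ := fun _ : HyperEdge k n => M.edgeLaw (edgeParam k α n))
      (X := fun _ j => (j : ℝ)) fun _ => memLp_edgeLaw M _).le.trans ?_
    refine (Finset.sum_le_sum fun I _ => ?_).trans (sum_second_moment_le hkn hp M)
    exact variance_le_expectation_sq Measurable.of_discrete.aestronglyMeasurable

end Concentration

/-! ### The threshold -/

section Threshold

variable {𝒴 : Type*} [Fintype 𝒴] {W : ZMod 2 → 𝒴 → ℝ} {k : ℕ}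

/-- If `I / n → C α` then almost no capacity is lost. -/
lemma tendsto_measure_codeInfo_lt_zero (hW : IsBISO W) (hk : 2 ≤ k) {α : ℝ≥0} (hα : 0 < α)
    (hc : Tendsto (fun n : ℕ => tupleInfo hW k α n / n) atTop (𝓝 (capacity W * α))) (M : Model)
    {ε : ℝ} (hε : 0 < ε) :
    Tendsto (fun n : ℕ => ensemble M k α n
      {g | codeInfo W g < (capacity W - ε) * numEdges g}) atTop (𝓝 0) := by
  have hC := capacity_nonneg hW
  have hα' : (0 : ℝ) < α := by exact_mod_cast hα
  -- with this `δ`, errors of `δ n` in the information and in the number of edges cost at most `ε α n`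
  set δ : ℝ := ε * α / (1 + capacity W + ε) with hδ
  have hden : 0 < 1 + capacity W + ε := by positivity
  have hδpos : 0 < δ := by positivity
  have hδeq : δ * (1 + capacity W + ε) = ε * α := by rw [hδ]; field_simp
  have hlim := (tendsto_codeInfo_div hW hk hc M hδpos).add (tendsto_numEdges_div hk α M hδpos)
  rw [add_zero] at hlim
  refine tendsto_of_tendsto_of_tendsto_of_le_of_le' tendsto_const_nhds hlim
    (Eventually.of_forall fun _ => zero_le) ?_
  filter_upwards [eventually_gt_atTop 0] with n hn
  have hn' : (0 : ℝ) < n := by exact_mod_cast hn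
  refine (measure_mono fun g hg => ?_).trans (measure_union_le _ _)
  by_contra hbad
  simp only [Set.mem_union, Set.mem_ofPred_eq, not_or, not_le, abs_lt] at hbad hg
  obtain ⟨⟨h1, -⟩, h3, h4⟩ := hbad
  have h5 := div_lt_div_of_pos_right hg hn'
  rw [mul_div_assoc] at h5
  nlinarith [mul_nonneg hC (sub_pos.2 h4).le, mul_pos hε (by linarith : 0 < δ + (numEdges g / n - α))]

/-- If `I / n → c < C α` then a positive fraction of the capacity is lost. -/
lemma exists_tendsto_measure_codeInfo_lt_one (hW : IsBISO W) (hk : 2 ≤ k) {α : ℝ≥0} (hα : 0 < α)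
    {c : ℝ} (hc : Tendsto (fun n : ℕ => tupleInfo hW k α n / n) atTop (𝓝 c))
    (hlt : c < capacity W * α) (M : Model) :
    ∃ ε : ℝ, 0 < ε ∧ Tendsto (fun n : ℕ => ensemble M k α n
      {g | codeInfo W g < (capacity W - ε) * numEdges g}) atTop (𝓝 1) := by
  have hC := capacity_nonneg hW
  have hα' : (0 : ℝ) < α := by exact_mod_cast hα
  set d : ℝ := capacity W * α - c with hd
  have hdpos : 0 < d := by linarith
  -- half of the deficit pays for `ε`, the other half for the fluctuations of `I` and `m`
  set ε : ℝ := d / 2 / α with hε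
  have hεpos : 0 < ε := by positivity
  have hεeq : ε * α = d / 2 := by rw [hε]; field_simp
  set δ : ℝ := d / 2 / (1 + capacity W + ε) with hδ
  have hden : 0 < 1 + capacity W + ε := by positivity
  have hδpos : 0 < δ := by positivity
  have hδeq : δ * (1 + capacity W + ε) = d / 2 := by rw [hδ]; field_simp
  refine ⟨ε, hεpos, ?_⟩
  have hlim := (tendsto_codeInfo_div hW hk hc M hδpos).add (tendsto_numEdges_div hk α M hδpos)
  rw [add_zero] at hlim
  have hcompl : Tendsto (fun n : ℕ => ensemble M k α n
      {g | codeInfo W g < (capacity W - ε) * numEdges g}ᶜ) atTop (𝓝 0) := by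
    refine tendsto_of_tendsto_of_tendsto_of_le_of_le' tendsto_const_nhds hlim
      (Eventually.of_forall fun _ => zero_le) ?_
    filter_upwards [eventually_gt_atTop 0] with n hn
    have hn' : (0 : ℝ) < n := by exact_mod_cast hn
    refine (measure_mono fun g hg => ?_).trans (measure_union_le _ _)
    by_contra hbad
    simp only [Set.mem_union, Set.mem_ofPred_eq, not_or, not_le, abs_lt, Set.mem_compl_iff,
      not_lt] at hbad hg
    obtain ⟨⟨-, h2⟩, h3, h4⟩ := hbad
    have h5 := div_le_div_of_nonneg_right hg hn'.le
    rw [mul_div_assoc] at h5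
    nlinarith [mul_nonneg hC (by linarith : 0 ≤ numEdges g / n - α + δ),
      mul_pos hεpos (by linarith : 0 < δ - (numEdges g / n - α))]
  have hone := ENNReal.Tendsto.sub (tendsto_const_nhds (x := (1 : ENNReal))) hcompl
    (Or.inl ENNReal.one_ne_top)
  rw [tsub_zero] at hone
  refine hone.congr fun n => ?_
  rw [prob_compl_eq_one_sub MeasurableSet.of_discrete]
  exact ENNReal.sub_sub_cancel ENNReal.one_ne_top prob_le_one

end Threshold

end LDGM

end

theorem mainTheorem6 {𝒴 : Type*} [Fintype 𝒴] (k : ℕ) (hk : 0 < k) (hkeven : Even k)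
    (W : ZMod 2 → 𝒴 → ℝ) (hW : LDGM.IsBISO W) :
    -- convergence in probability of `I(X; Y) / n`, to the same constant in both models
    (∃ C : NNReal → ℝ, ∀ α : NNReal, 0 < α → ∀ M : LDGM.Model, ∀ ε : ℝ, 0 < ε →
      Tendsto (fun n : ℕ => LDGM.ensemble M k α n {g | ε ≤ |LDGM.codeInfo W g / n - C α|})
        atTop (𝓝 0)) ∧
    -- the threshold for `I(X; Y) / m`, where `m` is the number of code bits
    (0 < LDGM.capacity W → ∃ θ : NNReal, ∀ α : NNReal, 0 < α → ∀ M : LDGM.Model,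
      (α < θ → ∀ ε : ℝ, 0 < ε →
        Tendsto (fun n : ℕ => LDGM.ensemble M k α n
          {g | LDGM.codeInfo W g < (LDGM.capacity W - ε) * LDGM.numEdges g}) atTop (𝓝 0)) ∧
      (θ < α → ∃ ε : ℝ, 0 < ε ∧
        Tendsto (fun n : ℕ => LDGM.ensemble M k α n
          {g | LDGM.codeInfo W g < (LDGM.capacity W - ε) * LDGM.numEdges g}) atTop (𝓝 1))) := by
  have hk2 : 2 ≤ k := by
    obtain ⟨r, rfl⟩ := hkeven
    omega
  choose c hc using LDGM.exists_tendsto_tupleInfo_div hW hkeven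
  refine ⟨⟨c, fun α _ M ε hε => LDGM.tendsto_codeInfo_div hW hk2 (hc α) M hε⟩, fun hC => ?_⟩
  have hcap : ∀ α, c α ≤ LDGM.capacity W * α := fun α => by
    refine le_of_tendsto (hc α) ?_
    filter_upwards [eventually_gt_atTop 0] with n hn
    rw [div_le_iff₀ (by exact_mod_cast hn)]
    exact LDGM.tupleInfo_le_capacity hW k α n
  have hone : ∀ α, c α ≤ 1 := fun α => by
    refine le_of_tendsto (hc α) (Eventually.of_forall fun n => ?_)
    exact div_le_one_of_le₀ (LDGM.tupleInfo_le hW k α n) (Nat.cast_nonneg n)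
  -- the deficit `C α - c α` is nondecreasing in `α`
  have hmono : ∀ α β : NNReal, α ≤ β → c β ≤ c α + LDGM.capacity W * (β - α) := by
    intro α β hαβ
    refine le_of_tendsto_of_tendsto (hc β) ((hc α).add tendsto_const_nhds) ?_
    filter_upwards [eventually_gt_atTop 0] with n hn
    have hn' : (0 : ℝ) < n := by exact_mod_cast hn
    rw [div_le_iff₀ hn', add_mul, div_mul_cancel₀ _ hn'.ne']
    exact LDGM.tupleInfo_le_add hW k hαβ n
  set S : Set NNReal := {α | c α = LDGM.capacity W * α} with hS
  have hSne : S.Nonempty := by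
    refine ⟨0, le_antisymm (hcap 0) ?_⟩
    rw [NNReal.coe_zero, mul_zero]
    exact ge_of_tendsto' (hc 0) fun n => div_nonneg (LDGM.tupleInfo_nonneg hW k 0 n) n.cast_nonneg
  have hSbdd : BddAbove S := by
    refine ⟨(1 / LDGM.capacity W).toNNReal, fun α hα => ?_⟩
    rw [Real.le_toNNReal_iff_coe_le (by positivity), le_div_iff₀ hC, mul_comm]
    exact (show c α = _ from hα).ge.trans (hone α)
  refine ⟨sSup S, fun α hα M => ⟨fun hlt ε hε => ?_, fun hgt => ?_⟩⟩
  · obtain ⟨β, hβ, hαβ⟩ := exists_lt_of_lt_csSup hSne hlt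
    have hβ' : c β = LDGM.capacity W * β := hβ
    have heq : c α = LDGM.capacity W * α :=
      le_antisymm (hcap α) (by linarith [hmono α β hαβ.le])
    exact LDGM.tendsto_measure_codeInfo_lt_zero hW hk2 hα (heq ▸ hc α) M hε
  · have hne : c α ≠ LDGM.capacity W * α := fun h => (le_csSup hSbdd h).not_gt hgt
    exact LDGM.exists_tendsto_measure_codeInfo_lt_one hW hk2 hα (hc α)
      (lt_of_le_of_ne (hcap α) hne) M
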